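/- Let $\psi:\mathbb R\to\mathbb C$ be a wavelet, i.e. $\int(1+|t|)\,|\psi(t)|\,dt<\infty$, $\int\psi(t)\,dt=0$, $\int|\psi(t)|^2dt=1$, and the Fourier transform $\widehat\psi(\omega)=\int\psi(t)e^{-i\omega t}dt$ is real-valued. For $j\in\mathbb Z$ put $\psi_j(t)=2^{-j}\psi(2^{-j}t)$. Let $X=(X(t))_{t\in\mathbb R}$ be a real-valued, jointly measurable random process whose increments have finite second moments and are stationary: for every $s\in\mathbb R$ the processes $(X(t+s)-X(s))_{t}$ and $(X(t)-X(0))_{t}$ have the same finite-dimensional distributions. Let $\sigma_W(j)=\mathbb E\{|X\star\psi_j(t)|^2\}^{1/2}$ and, for $j,a,b\in\mathbb Z$, define the scattering cross-spectrum $$C_S(j,a,b)=\frac{\mathbb E\big\{\,|X\star\psi_j|\star\psi_{j-b}(t)\;\big(|X\star\psi_{j-a}|\star\psi_{j-b}(t)\big)^*\big\}}{\sigma_W(j)\,\sigma_W(j-a)}$$ (with $C_S(j,a,b)=0$ when the denominator is $0$), the expectations being taken at an arbitrary fixed time $t\in\mathbb R$. Then, for all $j,k\in\mathbb Z$ and $t\in\mathbb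 R$, the convolutions defining $X\star\psi_j(t)$ and $|X\star\psi_j|\star\psi_k(t)$ converge absolutely almost surely and have finite second moments, and, for every choice of $t$: 1. If $\psi$ is analytic, i.e. $\widehat\psi(\omega)=0$ for all $\omega<0$, if $X$ is a Gaussian process, and if $j,a\in\mathbb Z$ are such that $\widehat\psi_j(\omega)\,\widehat\psi_{j-a}(\omega)=0$ for all $\omega\in\mathbb R$, then $C_S(j,a,b)=0$ for all $b\in\mathbb Z$. 2. If $X$ is time-reversible, i.e. $(X(-t))_{t}$ and $(X(t))_{t}$ have the same finite-dimensional distributions, then $\operatorname{Im}C_S(j,a,b)=0$ for all $j,a,b\in\mathbb Z$. -/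

import Mathlib

open MeasureTheory ProbabilityTheory
open scoped Convolution ComplexConjugate

namespace Scattering

noncomputable section

/-- The Fourier transform with the angular-frequency convention
`f̂(ω) = ∫ f(t) e^{-iωt} dt`. -/
def angularFourier (f : ℝ → ℂ) (ω : ℝ) : ℂ :=
  ∫ t : ℝ, f t * Complex.exp (-(Complex.I * (ω : ℂ) * (t : ℂ)))

/-- A complex wavelet. The field `decay` makes precise how fast the wavelet decays: it has a finite
first absolute moment, so that it can be convolved with processes that grow linearly. -/
structure IsWavelet (ψ : ℝ → ℂ) : Prop where
  measurable : Measurable ψ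
  decay : Integrable (fun t : ℝ => (1 + |t|) * ‖ψ t‖)
  zero_average : ∫ t : ℝ, ψ t = 0
  unit_energy : ∫ t : ℝ, ‖ψ t‖ ^ 2 = 1
  real_fourier : ∀ ω : ℝ, (angularFourier ψ ω).im = 0

/-- The Fourier transform of `ψ` is carried by the nonnegative frequencies. -/
def IsAnalyticWavelet (ψ : ℝ → ℂ) : Prop :=
  ∀ ω : ℝ, ω < 0 → angularFourier ψ ω = 0

/-- The dilated wavelet `ψ_j(t) = 2^{-j} ψ(2^{-j} t)`. -/
def dilate (ψ : ℝ → ℂ) (j : ℤ) (t : ℝ) : ℂ :=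
  ((2 : ℝ) ^ (-j) : ℝ) * ψ ((2 : ℝ) ^ (-j) * t)

/-- The wavelet transform `W x(t, j) = x ⋆ ψ_j (t)` of a real signal. -/
def waveletTransform (ψ : ℝ → ℂ) (x : ℝ → ℝ) (j : ℤ) (t : ℝ) : ℂ :=
  (x ⋆ dilate ψ j) t

/-- The modulus `|x ⋆ ψ_j|`, as a real signal. -/
def waveletModulus (ψ : ℝ → ℂ) (x : ℝ → ℝ) (j : ℤ) (t : ℝ) : ℝ :=
  ‖waveletTransform ψ x j t‖

/-- The scattering transform `S x(t; j, k) = |x ⋆ ψ_j| ⋆ ψ_k (t)`. -/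
def scatteringTransform (ψ : ℝ → ℂ) (x : ℝ → ℝ) (j k : ℤ) (t : ℝ) : ℂ :=
  waveletTransform ψ (waveletModulus ψ x j) k t

variable {Ω : Type*} [MeasurableSpace Ω]

/-- `σ_W(j) = E{|X ⋆ ψ_j(t)|²}^{1/2}`, computed at time `t`. -/
def waveletSigma (ψ : ℝ → ℂ) (X : ℝ → Ω → ℝ) (P : Measure Ω) (j : ℤ) (t : ℝ) : ℝ :=
  Real.sqrt (∫ ω, ‖waveletTransform ψ (fun u => X u ω) j t‖ ^ 2 ∂P)

/-- The scattering cross-spectrum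
`C_S(j,a,b) = E{|X ⋆ ψ_j| ⋆ ψ_{j-b}(t) (|X ⋆ ψ_{j-a}| ⋆ ψ_{j-b}(t))^*} / (σ_W(j) σ_W(j-a))`,
computed at time `t`. -/
def crossSpectrum (ψ : ℝ → ℂ) (X : ℝ → Ω → ℝ) (P : Measure Ω) (j a b : ℤ) (t : ℝ) : ℂ :=
  (∫ ω, scatteringTransform ψ (fun u => X u ω) j (j - b) t *
      conj (scatteringTransform ψ (fun u => X u ω) (j - a) (j - b) t) ∂P) /
    ((waveletSigma ψ X P j t * waveletSigma ψ X P (j - a) t : ℝ) : ℂ)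

/-- The increments of `X` are (strictly) stationary: the finite-dimensional distributions of
`(X(t + s) - X(s))_t` do not depend on `s`. -/
def HasStationaryIncrements (X : ℝ → Ω → ℝ) (P : Measure Ω) : Prop :=
  ∀ s : ℝ, IdentDistrib (fun ω (t : ℝ) => X (t + s) ω - X s ω)
    (fun ω (t : ℝ) => X t ω - X 0 ω) P P

/-- `X` and its time reversal `t ↦ X(-t)` have the same distribution. -/
def IsTimeReversible (X : ℝ → Ω → ℝ) (P : Measure Ω) : Prop :=
  IdentDistrib (fun ω (t : ℝ) => X (-t) ω) (fun ω (t : ℝ) => X t ω) P P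

/-- The convolutions defining `X ⋆ ψ_j(t)` and `|X ⋆ ψ_j| ⋆ ψ_k(t)` converge absolutely almost
surely, and the resulting random variables have finite second moments. -/
def IsWellDefined (ψ : ℝ → ℂ) (X : ℝ → Ω → ℝ) (P : Measure Ω) : Prop :=
  (∀ (j : ℤ) (t : ℝ),
    (∀ᵐ ω ∂P, ConvolutionExistsAt (fun u => X u ω) (dilate ψ j) t
      (ContinuousLinearMap.lsmul ℝ ℝ) volume) ∧
    MemLp (fun ω => waveletTransform ψ (fun u => X u ω) j t) 2 P) ∧
  (∀ (j k : ℤ) (t : ℝ),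
    (∀ᵐ ω ∂P, ConvolutionExistsAt (waveletModulus ψ (fun u => X u ω) j) (dilate ψ k) t
      (ContinuousLinearMap.lsmul ℝ ℝ) volume) ∧
    MemLp (fun ω => scatteringTransform ψ (fun u => X u ω) j k t) 2 P)

end

end Scattering

/-! Stationary increments and Minkowski's inequality make the L² norm of X(t) - X(0) an even
subadditive function of t, hence at most linear in |t|. As ψ has zero mean and a finite first
moment, X may be replaced by X - X(0), and Cauchy–Schwarz with the weight 1 + |t| controls both
layers of the transform (`LinearGrowth.lintegral_sq_le`, `LinearGrowth.waveletModulus`). Fubini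
writes the numerator of C_S as the integral of M(p, q) = E |X⋆ψ_j(p)| |X⋆ψ_{j-a}(q)| against
ψ_{j-b}(t-p) times the conjugate of ψ_{j-b}(t-q) (`integral_scattering_mul_conj`).

Gaussian case: twice the covariance of X - X(0) is γ(s) + γ(r) - γ(s-r), where γ is the variance of
the increment. Against functions of zero mean only the last term survives, and it sees only their
correlation, whose Fourier transform vanishes: by the disjoint spectra for the covariance, by
analyticity for the pseudo-covariance. The coefficients at the two scales are jointly Gaussian,
hence independent (`indepFun_integral`). So M is a product of two means, constant by stationarity,
and the zero mean of ψ_{j-b} kills the integral.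

Reversible case: M is invariant under translations and under (p, q) ↦ (-p, -q), while a real ψ̂
forces ψ(-t) to be the conjugate of ψ(t) almost everywhere. Reflecting the variables identifies the
numerator with its conjugate.

Laws of path integrals come from density in L² rather than from Riemann sums: the integral lies in
the closed span of the values of the process (`LinearGrowth.exists_tendsto_linComb`). -/

namespace Scattering

open Set Filter Topology
open scoped ENNReal NNReal Pointwise FourierTransform SchwartzMap

variable {Ω : Type*} [MeasurableSpace Ω] {P : Measure Ω}

/-! ### Integrals of processes of linear growth against functions with a first moment. -/

section IntegralsOfPaths

variable {E : Type*} [NormedAddCommGroup E] [NormedSpace ℝ E] [MeasurableSpace E] [BorelSpace E]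
  [SecondCountableTopology E]

set_option linter.unusedSectionVars false

/-- A measurable function with a finite first absolute moment. -/
structure WeightedIntegrable (f : ℝ → E) : Prop where
  measurable : Measurable f
  integrable_weight : Integrable (fun t : ℝ => (1 + |t|) * ‖f t‖)

/-- A jointly measurable process whose `L²` norm at time `s` is at most `c (1 + |s|)`. -/
structure LinearGrowth (U : ℝ → Ω → ℝ) (P : Measure Ω) (c : ℝ≥0) : Prop where
  measurable : Measurable (Function.uncurry U)
  bound : ∀ s, ∫⁻ ω, ‖U s ω‖ₑ ^ 2 ∂P ≤ (c * ENNReal.ofReal (1 + |s|)) ^ 2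

/-- The weighted `L¹` norm of `f`. -/
noncomputable def weightedNorm (f : ℝ → E) : ℝ≥0∞ :=
  ∫⁻ s, ENNReal.ofReal (1 + |s|) * ‖f s‖ₑ

lemma one_add_abs_pos (s : ℝ) : 0 < 1 + |s| := by positivity

lemma WeightedIntegrable.weightedNorm_lt_top {f : ℝ → E} (hf : WeightedIntegrable f) :
    weightedNorm f < ∞ := by
  have h := hf.integrable_weight.2
  refine lt_of_eq_of_lt ?_ h
  refine lintegral_congr fun s => ?_
  rw [enorm_mul, enorm_norm, Real.enorm_eq_ofReal (one_add_abs_pos s).le]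

lemma WeightedIntegrable.of_lt_top {f : ℝ → E} (hf : Measurable f) (h : weightedNorm f < ∞) :
    WeightedIntegrable f := by
  refine ⟨hf, ⟨by fun_prop, lt_of_eq_of_lt ?_ h⟩⟩
  refine lintegral_congr fun s => ?_
  rw [enorm_mul, enorm_norm, Real.enorm_eq_ofReal (one_add_abs_pos s).le]

lemma WeightedIntegrable.integrable {f : ℝ → E} (hf : WeightedIntegrable f) : Integrable f := by
  refine hf.integrable_weight.mono hf.measurable.aestronglyMeasurable (ae_of_all _ fun s => ?_)
  rw [norm_mul, norm_norm, Real.norm_of_nonneg (one_add_abs_pos s).le]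
  nlinarith [norm_nonneg (f s), abs_nonneg s]

/-- Cauchy–Schwarz for the pair a, 1 under the measure of density ρ. -/
lemma sq_lintegral_mul_le {α : Type*} [MeasurableSpace α] {μ : Measure α} {a ρ : α → ℝ≥0∞}
    (ha : Measurable a) (hρ : Measurable ρ) :
    (∫⁻ x, a x * ρ x ∂μ) ^ 2 ≤ (∫⁻ x, a x ^ 2 * ρ x ∂μ) * ∫⁻ x, ρ x ∂μ := by
  have h := ENNReal.lintegral_mul_le_Lp_mul_Lq (μ.withDensity ρ) Real.HolderConjugate.two_two
    ha.aemeasurable (aemeasurable_const (b := (1 : ℝ≥0∞)))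
  simp only [Pi.mul_apply, mul_one, ENNReal.one_rpow, lintegral_const, one_mul] at h
  have h1 : ∀ g : α → ℝ≥0∞, Measurable g →
      ∫⁻ x, g x ∂(μ.withDensity ρ) = ∫⁻ x, g x * ρ x ∂μ := fun g hg => by
    rw [lintegral_withDensity_eq_lintegral_mul _ hρ hg]
    simp [mul_comm]
  rw [h1 _ ha, h1 _ (by fun_prop), withDensity_apply _ MeasurableSet.univ,
    Measure.restrict_univ] at h
  calc (∫⁻ x, a x * ρ x ∂μ) ^ 2
      ≤ ((∫⁻ x, a x ^ (2 : ℝ) * ρ x ∂μ) ^ (1 / 2 : ℝ) * (∫⁻ x, ρ x ∂μ) ^ (1 / 2 : ℝ)) ^ 2 := by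
        gcongr
    _ = _ := by
        rw [mul_pow, ← ENNReal.rpow_natCast, ← ENNReal.rpow_natCast, ← ENNReal.rpow_mul,
          ← ENNReal.rpow_mul]
        norm_num

/-- Cauchy–Schwarz under the measure w |f| ds, with w = 1 + |s|, leaves (|U|/w)² inside. After
Tonelli its expectation is at most c², uniformly in s. Every integrability claim below rests on this
estimate. -/
lemma LinearGrowth.lintegral_sq_le [SFinite P] {U : ℝ → Ω → ℝ} {c : ℝ≥0} (hU : LinearGrowth U P c)
    {f : ℝ → E} (hf : Measurable f) :
    ∫⁻ ω, (∫⁻ s, ‖U s ω‖ₑ * ‖f s‖ₑ) ^ 2 ∂P ≤ (c * weightedNorm f) ^ 2 := by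
  have hm : Measurable (fun p : ℝ × Ω => U p.1 p.2) := hU.measurable
  set w : ℝ → ℝ≥0∞ := fun s => ENNReal.ofReal (1 + |s|) with hw
  have hwm : Measurable w := by fun_prop
  have hw0 : ∀ s, w s ≠ 0 := fun s => by simp [hw, one_add_abs_pos]
  have hwt : ∀ s, w s ≠ ∞ := fun s => by simp [hw]
  have hcs : ∀ ω, (∫⁻ s, ‖U s ω‖ₑ * ‖f s‖ₑ) ^ 2 ≤
      (∫⁻ s, ((w s)⁻¹ * ‖U s ω‖ₑ) ^ 2 * (w s * ‖f s‖ₑ)) * weightedNorm f := fun ω => by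
    have hUm : Measurable fun s => U s ω := hm.comp (by fun_prop : Measurable fun s : ℝ => (s, ω))
    refine le_trans (le_of_eq ?_) (sq_lintegral_mul_le (μ := volume)
      (a := fun s => (w s)⁻¹ * ‖U s ω‖ₑ) (ρ := fun s => w s * ‖f s‖ₑ) (by fun_prop) (by fun_prop))
    congr 1
    refine lintegral_congr fun s => ?_
    calc ‖U s ω‖ₑ * ‖f s‖ₑ = ((w s)⁻¹ * w s) * (‖U s ω‖ₑ * ‖f s‖ₑ) := by
          rw [ENNReal.inv_mul_cancel (hw0 s) (hwt s), one_mul]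
      _ = _ := by ring
  calc ∫⁻ ω, (∫⁻ s, ‖U s ω‖ₑ * ‖f s‖ₑ) ^ 2 ∂P
      ≤ ∫⁻ ω, (∫⁻ s, ((w s)⁻¹ * ‖U s ω‖ₑ) ^ 2 * (w s * ‖f s‖ₑ)) * weightedNorm f ∂P :=
        lintegral_mono hcs
    _ = (∫⁻ s, ∫⁻ ω, ((w s)⁻¹ * ‖U s ω‖ₑ) ^ 2 * (w s * ‖f s‖ₑ) ∂P) * weightedNorm f := by
        rw [lintegral_mul_const'', lintegral_lintegral_swap]
        · apply Measurable.aemeasurable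
          apply Measurable.mul
          · have : Measurable fun p : Ω × ℝ => U p.2 p.1 := hm.comp measurable_swap
            fun_prop
          · fun_prop
        · apply Measurable.aemeasurable
          apply Measurable.lintegral_prod_right'
            (f := fun p : Ω × ℝ => ((w p.2)⁻¹ * ‖U p.2 p.1‖ₑ) ^ 2 * (w p.2 * ‖f p.2‖ₑ))
          have : Measurable fun p : Ω × ℝ => U p.2 p.1 := hm.comp measurable_swap
          fun_prop
    _ ≤ (∫⁻ s, (c : ℝ≥0∞) ^ 2 * (w s * ‖f s‖ₑ)) * weightedNorm f := by
        gcongr with s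
        have hUm : Measurable fun ω => U s ω := hm.comp (by fun_prop : Measurable fun ω : Ω => (s, ω))
        rw [lintegral_mul_const _ (by fun_prop)]
        gcongr
        simp_rw [mul_pow]
        rw [lintegral_const_mul _ (by fun_prop)]
        calc (w s)⁻¹ ^ 2 * ∫⁻ ω, ‖U s ω‖ₑ ^ 2 ∂P ≤ (w s)⁻¹ ^ 2 * ((c : ℝ≥0∞) * w s) ^ 2 := by
              gcongr; exact hU.bound s
          _ = (c : ℝ≥0∞) ^ 2 := by
              rw [← mul_pow, mul_left_comm, ENNReal.inv_mul_cancel (hw0 s) (hwt s), mul_one]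
    _ = _ := by
        rw [lintegral_const_mul _ (by fun_prop)]
        unfold weightedNorm
        ring

lemma LinearGrowth.memLp_eval {U : ℝ → Ω → ℝ} {c : ℝ≥0} (hU : LinearGrowth U P c) (s : ℝ) :
    MemLp (U s) 2 P := by
  have hm : Measurable (fun p : ℝ × Ω => U p.1 p.2) := hU.measurable
  have hUm : Measurable fun ω => U s ω := hm.comp (by fun_prop : Measurable fun ω : Ω => (s, ω))
  refine ⟨hUm.aestronglyMeasurable, ?_⟩
  rw [eLpNorm_lt_top_iff_lintegral_rpow_enorm_lt_top (by simp) (by simp)]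
  refine lt_of_le_of_lt ?_ (lt_of_le_of_lt (hU.bound s) ?_)
  · simp
  · exact ENNReal.pow_lt_top (ENNReal.mul_lt_top ENNReal.coe_lt_top ENNReal.ofReal_lt_top)

lemma measurable_integral_smul {T : Type*} [MeasurableSpace T] {U : ℝ → Ω → ℝ}
    (hU : Measurable (Function.uncurry U)) {f : T → ℝ → E} (hf : Measurable (Function.uncurry f)) :
    StronglyMeasurable (fun p : T × Ω => ∫ s, U s p.2 • f p.1 s) := by
  have hm : Measurable (fun p : ℝ × Ω => U p.1 p.2) := hU
  have hf' : Measurable (fun p : T × ℝ => f p.1 p.2) := hf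
  refine StronglyMeasurable.integral_prod_right
    (f := fun (p : T × Ω) (s : ℝ) => U s p.2 • f p.1 s) ?_
  apply Measurable.stronglyMeasurable
  exact (hm.comp (by fun_prop : Measurable fun q : (T × Ω) × ℝ => (q.2, q.1.2))).smul
    (hf'.comp (by fun_prop : Measurable fun q : (T × Ω) × ℝ => (q.1.1, q.2)))

lemma stronglyMeasurable_integral_smul {U : ℝ → Ω → ℝ}
    (hU : Measurable (Function.uncurry U)) {f : ℝ → E} (hf : Measurable f) :
    StronglyMeasurable (fun ω => ∫ s, U s ω • f s) :=
  (measurable_integral_smul (T := Unit) (f := fun _ => f) hU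
    (hf.comp measurable_snd)).comp_measurable (by fun_prop : Measurable fun ω : Ω => ((), ω))

lemma LinearGrowth.measurable_lintegral {U : ℝ → Ω → ℝ} {c : ℝ≥0} (hU : LinearGrowth U P c)
    {f : ℝ → E} (hf : Measurable f) :
    Measurable (fun ω => ∫⁻ s, ‖U s ω‖ₑ * ‖f s‖ₑ) := by
  apply Measurable.lintegral_prod_right' (f := fun p : Ω × ℝ => ‖U p.2 p.1‖ₑ * ‖f p.2‖ₑ)
  have h : Measurable fun p : Ω × ℝ => U p.2 p.1 := hU.measurable.comp measurable_swap
  exact h.enorm.mul (hf.comp measurable_snd).enorm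

lemma LinearGrowth.ae_integrable [SFinite P] {U : ℝ → Ω → ℝ} {c : ℝ≥0} (hU : LinearGrowth U P c)
    {f : ℝ → E} (hf : WeightedIntegrable f) :
    ∀ᵐ ω ∂P, Integrable (fun s => U s ω • f s) := by
  have h := (hU.lintegral_sq_le hf.measurable).trans_lt
    (ENNReal.pow_lt_top (ENNReal.mul_lt_top ENNReal.coe_lt_top hf.weightedNorm_lt_top))
  filter_upwards [ae_lt_top ((hU.measurable_lintegral hf.measurable).pow_const 2) h.ne] with ω hω
  have hUm : Measurable fun s => U s ω :=
    hU.measurable.comp (by fun_prop : Measurable fun s : ℝ => (s, ω))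
  refine ⟨(hUm.smul hf.measurable).aestronglyMeasurable, ?_⟩
  simp only [HasFiniteIntegral, enorm_smul]
  simpa using hω

lemma LinearGrowth.lintegral_enorm_integral_sq_le [SFinite P] {U : ℝ → Ω → ℝ} {c : ℝ≥0}
    (hU : LinearGrowth U P c) {f : ℝ → E} (hf : Measurable f) :
    ∫⁻ ω, ‖∫ s, U s ω • f s‖ₑ ^ 2 ∂P ≤ (c * weightedNorm f) ^ 2 := by
  refine le_trans (lintegral_mono fun ω => ?_) (hU.lintegral_sq_le hf)
  gcongr
  refine (enorm_integral_le_lintegral_enorm _).trans (le_of_eq ?_)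
  simp [enorm_smul]

lemma LinearGrowth.memLp_integral [SFinite P] {U : ℝ → Ω → ℝ} {c : ℝ≥0}
    (hU : LinearGrowth U P c) {f : ℝ → E} (hf : WeightedIntegrable f) :
    MemLp (fun ω => ∫ s, U s ω • f s) 2 P := by
  refine ⟨(stronglyMeasurable_integral_smul hU.measurable hf.measurable).aestronglyMeasurable, ?_⟩
  rw [eLpNorm_lt_top_iff_lintegral_rpow_enorm_lt_top (by simp) (by simp)]
  refine lt_of_le_of_lt ?_ (lt_of_le_of_lt (hU.lintegral_enorm_integral_sq_le hf.measurable)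
    (ENNReal.pow_lt_top (ENNReal.mul_lt_top ENNReal.coe_lt_top hf.weightedNorm_lt_top)))
  simp

lemma ennreal_mul_le_sq_add_sq (a b : ℝ≥0∞) : a * b ≤ a ^ 2 + b ^ 2 := by
  rcases le_total a b with h | h
  · calc a * b ≤ b * b := by gcongr
      _ ≤ _ := by rw [sq b]; exact le_add_self
  · calc a * b ≤ a * a := by gcongr
      _ ≤ _ := by rw [sq a]; exact le_self_add

/-- Licenses Fubini for products of two path integrals: the product is dominated by the sum of
squares, and both squares have finite expectation. -/
lemma LinearGrowth.integrable_kernel [SFinite P] {U V : ℝ → Ω → ℝ} {c d : ℝ≥0}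
    (hU : LinearGrowth U P c) (hV : LinearGrowth V P d) {f g : ℝ → ℂ}
    (hf : WeightedIntegrable f) (hg : WeightedIntegrable g) :
    Integrable (fun p : Ω × (ℝ × ℝ) => (U p.2.1 p.1 • f p.2.1) * (V p.2.2 p.1 • g p.2.2))
      (P.prod (volume.prod volume)) := by
  have hfm := hf.measurable
  have hgm := hg.measurable
  have h1 : Measurable fun p : Ω × (ℝ × ℝ) => U p.2.1 p.1 :=
    hU.measurable.comp (by fun_prop : Measurable fun p : Ω × (ℝ × ℝ) => (p.2.1, p.1))
  have h2 : Measurable fun p : Ω × (ℝ × ℝ) => V p.2.2 p.1 :=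
    hV.measurable.comp (by fun_prop : Measurable fun p : Ω × (ℝ × ℝ) => (p.2.2, p.1))
  have hmeas : Measurable (fun p : Ω × (ℝ × ℝ) =>
      (U p.2.1 p.1 • f p.2.1) * (V p.2.2 p.1 • g p.2.2)) :=
    (h1.smul (hfm.comp (by fun_prop))).mul (h2.smul (hgm.comp (by fun_prop)))
  refine ⟨hmeas.aestronglyMeasurable, ?_⟩
  rw [HasFiniteIntegral, lintegral_prod _ hmeas.enorm.aemeasurable]
  have hin : ∀ ω, ∫⁻ p : ℝ × ℝ, ‖(U p.1 ω • f p.1) * (V p.2 ω • g p.2)‖ₑ ∂(volume.prod volume)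
      = (∫⁻ s, ‖U s ω‖ₑ * ‖f s‖ₑ) * (∫⁻ s, ‖V s ω‖ₑ * ‖g s‖ₑ) := fun ω => by
    have hUm : Measurable fun s => U s ω :=
      hU.measurable.comp (by fun_prop : Measurable fun s : ℝ => (s, ω))
    have hVm : Measurable fun s => V s ω :=
      hV.measurable.comp (by fun_prop : Measurable fun s : ℝ => (s, ω))
    rw [← lintegral_prod_mul (by fun_prop) (by fun_prop)]
    simp only [enorm_mul, enorm_smul]
  simp_rw [hin]
  refine lt_of_le_of_lt (lintegral_mono fun ω => ennreal_mul_le_sq_add_sq _ _) ?_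
  rw [lintegral_add_left ((hU.measurable_lintegral hfm).pow_const 2)]
  refine ENNReal.add_lt_top.2 ⟨(hU.lintegral_sq_le hfm).trans_lt ?_,
    (hV.lintegral_sq_le hgm).trans_lt ?_⟩
  · exact ENNReal.pow_lt_top (ENNReal.mul_lt_top ENNReal.coe_lt_top hf.weightedNorm_lt_top)
  · exact ENNReal.pow_lt_top (ENNReal.mul_lt_top ENNReal.coe_lt_top hg.weightedNorm_lt_top)

lemma LinearGrowth.integral_mul_integral [SFinite P] {U V : ℝ → Ω → ℝ} {c d : ℝ≥0}
    (hU : LinearGrowth U P c) (hV : LinearGrowth V P d) {f g : ℝ → ℂ}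
    (hf : WeightedIntegrable f) (hg : WeightedIntegrable g) :
    ∫ ω, (∫ s, U s ω • f s) * (∫ r, V r ω • g r) ∂P =
      ∫ p : ℝ × ℝ, ((∫ ω, U p.1 ω * V p.2 ω ∂P : ℝ) : ℂ) * (f p.1 * g p.2) := by
  have h := integral_integral_swap (f := fun ω (p : ℝ × ℝ) => (U p.1 ω • f p.1) * (V p.2 ω • g p.2))
    (hU.integrable_kernel hV hf hg)
  have hin : ∀ ω, (∫ s, U s ω • f s) * (∫ r, V r ω • g r) =
      ∫ p : ℝ × ℝ, (U p.1 ω • f p.1) * (V p.2 ω • g p.2) ∂(volume.prod volume) := fun ω =>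
    (integral_prod_mul (fun s => U s ω • f s) (fun r => V r ω • g r)).symm
  simp_rw [hin]
  rw [h]
  refine integral_congr_ae (ae_of_all _ fun p => ?_)
  simp only [← integral_complex_ofReal, ← integral_mul_const]
  refine integral_congr_ae (ae_of_all _ fun ω => ?_)
  simp only [Complex.real_smul]
  push_cast
  ring

lemma LinearGrowth.integrable_moment_kernel [SFinite P] {U V : ℝ → Ω → ℝ} {c d : ℝ≥0}
    (hU : LinearGrowth U P c) (hV : LinearGrowth V P d) {f g : ℝ → ℂ}
    (hf : WeightedIntegrable f) (hg : WeightedIntegrable g) :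
    Integrable (fun p : ℝ × ℝ => ((∫ ω, U p.1 ω * V p.2 ω ∂P : ℝ) : ℂ) * (f p.1 * g p.2)) := by
  have h := (hU.integrable_kernel hV hf hg).integral_prod_right
  refine h.congr (ae_of_all _ fun p => ?_)
  simp only [← integral_complex_ofReal, ← integral_mul_const]
  refine integral_congr_ae (ae_of_all _ fun ω => ?_)
  simp only [Complex.real_smul]
  push_cast
  ring

/-! ### Laws of path integrals through L² approximation. -/

/-- The finite linear combination `∑ a_t U(t)` of the values of a process. -/
noncomputable def linComb (U : ℝ → Ω → ℝ) (l : ℝ →₀ ℝ) (ω : Ω) : ℝ := l.sum fun t a => a * U t ω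

lemma LinearGrowth.memLp_linComb {U : ℝ → Ω → ℝ} {c : ℝ≥0} (hU : LinearGrowth U P c)
    (l : ℝ →₀ ℝ) : MemLp (linComb U l) 2 P :=
  memLp_finsetSum _ fun t _ => (hU.memLp_eval t).const_mul (l t)

lemma WeightedIntegrable.ofReal {φ : ℝ → ℝ} (hφ : WeightedIntegrable φ) :
    WeightedIntegrable (fun s => (φ s : ℂ)) :=
  ⟨by have := hφ.measurable; fun_prop, by simpa using hφ.integrable_weight⟩

lemma weightedIntegrable_indicator_Ioc :
    WeightedIntegrable (fun s : ℝ => (Ioc (0 : ℝ) 1).indicator (fun _ => (1 : ℂ)) s) := by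
  refine ⟨measurable_const.indicator measurableSet_Ioc, ?_⟩
  have h : IntegrableOn (fun _ : ℝ => (2 : ℝ)) (Ioc 0 1) := by simp
  refine (h.integrable_indicator measurableSet_Ioc).mono ?_ (ae_of_all _ fun s => ?_)
  · have h1 : Measurable ((Ioc (0 : ℝ) 1).indicator (fun _ => (1 : ℂ))) :=
      measurable_const.indicator measurableSet_Ioc
    exact (by fun_prop : Measurable fun s : ℝ =>
      (1 + |s|) * ‖(Ioc (0 : ℝ) 1).indicator (fun _ => (1 : ℂ)) s‖).aestronglyMeasurable
  · by_cases hs : s ∈ Ioc (0 : ℝ) 1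
    · simp only [indicator_of_mem hs, norm_one, mul_one]
      rw [abs_of_pos hs.1, Real.norm_of_nonneg (by linarith [hs.1]), Real.norm_of_nonneg (by norm_num)]
      linarith [hs.2]
    · simp [indicator_of_notMem hs]

/-- A random variable orthogonal to all values of a process is orthogonal to its integrals. -/
lemma LinearGrowth.integral_mul_eq_zero [SFinite P] {U : ℝ → Ω → ℝ} {c : ℝ≥0}
    (hU : LinearGrowth U P c) {φ : ℝ → ℝ} (hφ : WeightedIntegrable φ) {W : Ω → ℝ}
    (hWm : Measurable W) (hW : MemLp W 2 P) (h : ∀ t, ∫ ω, U t ω * W ω ∂P = 0) :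
    ∫ ω, (∫ s, U s ω • φ s) * W ω ∂P = 0 := by
  have hfin : ∫⁻ ω, ‖W ω‖ₑ ^ 2 ∂P < ∞ := by
    have := (eLpNorm_lt_top_iff_lintegral_rpow_enorm_lt_top (by simp) (by simp)).1 hW.2
    simpa using this
  obtain ⟨d, hd⟩ : ∃ d : ℝ≥0, ∫⁻ ω, ‖W ω‖ₑ ^ 2 ∂P ≤ (d : ℝ≥0∞) ^ 2 := by
    -- The added 1 makes the constant at least 1, hence at most its own square.
    refine ⟨((∫⁻ ω, ‖W ω‖ₑ ^ 2 ∂P) + 1).toNNReal, ?_⟩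
    rw [ENNReal.coe_toNNReal (by simp [hfin.ne])]
    calc _ ≤ (∫⁻ ω, ‖W ω‖ₑ ^ 2 ∂P) + 1 := le_self_add
      _ ≤ _ := le_self_pow₀ le_add_self (by norm_num)
  -- W is regarded as a process constant in time; integrated against the indicator of (0, 1] it
  -- returns W, so the product formula for two path integrals applies.
  have hV : LinearGrowth (fun _ ω => W ω) P d := by
    refine ⟨hWm.comp measurable_snd, fun s => hd.trans ?_⟩
    gcongr
    refine le_mul_of_one_le_right zero_le ?_
    rw [← ENNReal.ofReal_one]
    exact ENNReal.ofReal_le_ofReal (by linarith [abs_nonneg s])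
  have key := hU.integral_mul_integral hV hφ.ofReal weightedIntegrable_indicator_Ioc
  simp only [h, Complex.ofReal_zero, zero_mul, integral_zero, Complex.real_smul] at key
  have h1 : ∀ ω, ∫ r : ℝ, (W ω : ℂ) * (Ioc (0 : ℝ) 1).indicator (fun _ => (1 : ℂ)) r = W ω := by
    intro ω
    rw [integral_const_mul, integral_indicator measurableSet_Ioc]
    simp
  simp only [h1, ← Complex.ofReal_mul, integral_complex_ofReal] at key
  exact_mod_cast key

/-- In the Hilbert space L², whatever is orthogonal to all values U(t) is orthogonal to the
integral, so the integral lies in the closure of their span. Unlike with Riemann sums, no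
mean-square continuity is required. -/
lemma LinearGrowth.exists_tendsto_linComb [IsFiniteMeasure P] {U : ℝ → Ω → ℝ} {c : ℝ≥0}
    (hU : LinearGrowth U P c) {φ : ℝ → ℝ} (hφ : WeightedIntegrable φ) :
    ∃ l : ℕ → ℝ →₀ ℝ, Tendsto
      (fun n => eLpNorm (linComb U (l n) - fun ω => ∫ s, U s ω • φ s) 2 P) atTop (𝓝 0) := by
  set A : Lp ℝ 2 P := (hU.memLp_integral hφ).toLp with hA
  set u : ℝ → Lp ℝ 2 P := fun t => (hU.memLp_eval t).toLp with hu
  set K := Submodule.span ℝ (range u) with hK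
  have hmem : A ∈ K.topologicalClosure := by
    rw [← Submodule.orthogonal_orthogonal_eq_closure, Submodule.mem_orthogonal]
    intro W hW
    rw [L2.inner_def]
    have hz := hU.integral_mul_eq_zero hφ (Lp.stronglyMeasurable W).measurable (Lp.memLp W)
      (fun t => by
        have := (Submodule.mem_orthogonal _ _).1 hW (u t) (Submodule.subset_span ⟨t, rfl⟩)
        rw [L2.inner_def] at this
        rw [← this]
        refine integral_congr_ae ?_
        filter_upwards [(hU.memLp_eval t).coeFn_toLp] with ω hω
        simp only [hu]
        rw [hω]
        simp [mul_comm])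
    rw [← hz]
    refine integral_congr_ae ?_
    filter_upwards [(hU.memLp_integral hφ).coeFn_toLp] with ω hω
    rw [hA, hω]
    simp
  have hspan : ∀ x ∈ K, ∃ l : ℝ →₀ ℝ, x =ᵐ[P] linComb U l := by
    intro x hx
    induction hx using Submodule.span_induction with
    | mem x hx =>
      obtain ⟨t, rfl⟩ := hx
      refine ⟨Finsupp.single t 1, ?_⟩
      filter_upwards [(hU.memLp_eval t).coeFn_toLp] with ω hω
      simp [linComb, hu, hω]
    | zero =>
      refine ⟨0, ?_⟩
      filter_upwards [Lp.coeFn_zero ℝ 2 P] with ω hω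
      rw [hω]
      simp [linComb]
    | add x y _ _ hx hy =>
      obtain ⟨l, hl⟩ := hx
      obtain ⟨m, hm⟩ := hy
      refine ⟨l + m, ?_⟩
      filter_upwards [hl, hm, Lp.coeFn_add x y] with ω h1 h2 h3
      rw [h3, Pi.add_apply, h1, h2]
      simp only [linComb]
      rw [Finsupp.sum_add_index' (by simp) (by intros; ring)]
    | smul a x _ hx =>
      obtain ⟨l, hl⟩ := hx
      refine ⟨a • l, ?_⟩
      filter_upwards [hl, Lp.coeFn_smul a x] with ω h1 h3
      rw [h3, Pi.smul_apply, h1]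
      simp only [linComb]
      rw [Finsupp.sum_smul_index (by simp), Finsupp.smul_sum]
      simp [mul_assoc]
  obtain ⟨x, hxK, hxA⟩ := mem_closure_iff_seq_limit.1
    (show A ∈ closure (K : Set (Lp ℝ 2 P)) from hmem)
  choose l hl using fun n => hspan (x n) (hxK n)
  refine ⟨l, ?_⟩
  rw [Lp.tendsto_Lp_iff_tendsto_eLpNorm'] at hxA
  refine hxA.congr fun n => eLpNorm_congr_ae ?_
  exact (hl n).sub (hU.memLp_integral hφ).coeFn_toLp

/-- The function x ↦ e^{ix} is 1-Lipschitz, and L² convergence implies L¹ convergence under a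
probability measure. -/
lemma tendsto_integral_cexp [IsProbabilityMeasure P] {A : Ω → ℝ} {B : ℕ → Ω → ℝ}
    (hA : MemLp A 2 P) (hB : ∀ n, MemLp (B n) 2 P)
    (h : Tendsto (fun n => eLpNorm (B n - A) 2 P) atTop (𝓝 0)) :
    Tendsto (fun n => ∫ ω, Complex.exp (B n ω * Complex.I) ∂P) atTop
      (𝓝 (∫ ω, Complex.exp (A ω * Complex.I) ∂P)) := by
  have hint : ∀ {f : Ω → ℝ}, MemLp f 2 P →
      Integrable (fun ω => Complex.exp (f ω * Complex.I)) P := fun {f} hf => by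
    refine Integrable.of_bound (C := 1) ?_ (ae_of_all _ fun ω => ?_)
    · exact (by fun_prop : Continuous fun x : ℝ =>
        Complex.exp (x * Complex.I)).comp_aestronglyMeasurable hf.1
    · rw [Complex.norm_exp_ofReal_mul_I]
  refine tendsto_integral_of_L1 _ (hint hA).1 (Eventually.of_forall fun n => hint (hB n)) ?_
  refine tendsto_of_tendsto_of_tendsto_of_le_of_le tendsto_const_nhds h (fun n => zero_le)
    fun n => ?_
  refine le_trans ?_ (eLpNorm_le_eLpNorm_of_exponent_le one_le_two ((hB n).1.sub hA.1))
  rw [eLpNorm_one_eq_lintegral_enorm]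
  refine lintegral_mono fun ω => ?_
  have he : Complex.exp (B n ω * Complex.I) - Complex.exp (A ω * Complex.I) =
      Complex.exp (A ω * Complex.I) * (Complex.exp (Complex.I * ((B n ω - A ω : ℝ) : ℂ)) - 1) := by
    rw [mul_sub, ← Complex.exp_add, mul_one]
    congr 2
    push_cast
    ring
  rw [he, enorm_mul, Pi.sub_apply]
  have h1 : ‖Complex.exp (A ω * Complex.I)‖ₑ = 1 := by
    rw [← ofReal_norm, Complex.norm_exp_ofReal_mul_I, ENNReal.ofReal_one]
  rw [h1, one_mul]
  exact Real.enorm_exp_I_mul_ofReal_sub_one_le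

lemma tendsto_integral_and_variance [IsProbabilityMeasure P] {A : Ω → ℝ} {B : ℕ → Ω → ℝ}
    (hA : MemLp A 2 P) (hB : ∀ n, MemLp (B n) 2 P)
    (h : Tendsto (fun n => eLpNorm (B n - A) 2 P) atTop (𝓝 0)) :
    Tendsto (fun n => ∫ ω, B n ω ∂P) atTop (𝓝 (∫ ω, A ω ∂P)) ∧
    Tendsto (fun n => Var[B n; P]) atTop (𝓝 (Var[A; P])) := by
  have hmean : Tendsto (fun n => ∫ ω, B n ω ∂P) atTop (𝓝 (∫ ω, A ω ∂P)) := by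
    refine tendsto_integral_of_L1 _ hA.1
      (Eventually.of_forall fun n => (hB n).integrable one_le_two) ?_
    refine tendsto_of_tendsto_of_tendsto_of_le_of_le tendsto_const_nhds h (fun n => zero_le)
      fun n => ?_
    refine le_trans ?_ (eLpNorm_le_eLpNorm_of_exponent_le one_le_two ((hB n).1.sub hA.1))
    rw [eLpNorm_one_eq_lintegral_enorm]
    rfl
  refine ⟨hmean, ?_⟩
  have hlp : Tendsto (fun n => (hB n).toLp) atTop (𝓝 hA.toLp) := by
    rw [Lp.tendsto_Lp_iff_tendsto_eLpNorm']
    refine h.congr fun n => eLpNorm_congr_ae ?_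
    exact ((hB n).coeFn_toLp.sub hA.coeFn_toLp).symm
  have hsq : ∀ {f : Ω → ℝ} (hf : MemLp f 2 P), ‖hf.toLp‖ ^ 2 = ∫ ω, (f ^ 2) ω ∂P := by
    intro f hf
    rw [← real_inner_self_eq_norm_sq, L2.inner_def]
    refine integral_congr_ae ?_
    filter_upwards [hf.coeFn_toLp] with ω hω
    rw [hω]
    simp [sq]
  have h2 := (hlp.norm.pow 2)
  simp_rw [hsq] at h2
  simp_rw [fun n => variance_eq_sub (hB n), variance_eq_sub hA]
  exact h2.sub (hmean.pow 2)

/-- A continuous functional commutes with the integral, so laws of vector-valued integrals reduce to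
real-valued ones. -/
lemma charFunDual_map_integral [IsProbabilityMeasure P] [CompleteSpace E] {U : ℝ → Ω → ℝ} {c : ℝ≥0}
    (hU : LinearGrowth U P c) {f : ℝ → E} (hf : WeightedIntegrable f) (L : StrongDual ℝ E) :
    charFunDual (P.map fun ω => ∫ s, U s ω • f s) L =
      ∫ ω, Complex.exp ((∫ s, U s ω • L (f s) : ℝ) * Complex.I) ∂P := by
  rw [charFunDual_apply, integral_map
    (stronglyMeasurable_integral_smul hU.measurable hf.measurable).measurable.aemeasurable
    (by fun_prop)]
  refine integral_congr_ae ?_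
  filter_upwards [hU.ae_integrable hf] with ω hω
  rw [← L.integral_comp_comm hω]
  simp

lemma WeightedIntegrable.clm_comp {F : Type*} [NormedAddCommGroup F] [NormedSpace ℝ F]
    [MeasurableSpace F] [BorelSpace F] {f : ℝ → E} (hf : WeightedIntegrable f) (L : E →L[ℝ] F) :
    WeightedIntegrable (fun s => L (f s)) := by
  have hm : Measurable fun s => L (f s) := L.measurable.comp hf.measurable
  refine ⟨hm, (hf.integrable_weight.const_mul ‖L‖).mono ?_ (ae_of_all _ fun s => ?_)⟩
  · exact ((by fun_prop : Measurable fun s : ℝ => 1 + |s|).mul hm.norm).aestronglyMeasurable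
  · rw [norm_mul, norm_mul, norm_mul, norm_norm, norm_norm, norm_norm]
    calc _ ≤ ‖1 + |s|‖ * (‖L‖ * ‖f s‖) := by gcongr; exact L.le_opNorm _
      _ = _ := by ring

/-- Integrals of a Gaussian process are Gaussian. -/
lemma hasGaussianLaw_integral [IsProbabilityMeasure P] [CompleteSpace E] {U : ℝ → Ω → ℝ} {c : ℝ≥0}
    (hU : LinearGrowth U P c) (hG : IsGaussianProcess U P) {f : ℝ → E}
    (hf : WeightedIntegrable f) : HasGaussianLaw (fun ω => ∫ s, U s ω • f s) P := by
  rw [hasGaussianLaw_iff_charFunDual_map_eq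
    (stronglyMeasurable_integral_smul hU.measurable hf.measurable).measurable.aemeasurable]
  intro L
  rw [charFunDual_map_integral hU hf L]
  have hLf := hf.clm_comp L
  have hae : (L ∘ fun ω => ∫ s, U s ω • f s) =ᵐ[P] fun ω => ∫ s, U s ω • L (f s) := by
    filter_upwards [hU.ae_integrable hf] with ω hω
    rw [Function.comp_apply, ← L.integral_comp_comm hω]
    simp
  rw [integral_congr_ae hae, variance_congr hae]
  obtain ⟨l, hl⟩ := hU.exists_tendsto_linComb hLf
  have hA := hU.memLp_integral hLf
  have hB := fun n => hU.memLp_linComb (l n)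
  have h1 := tendsto_integral_cexp hA hB hl
  obtain ⟨hm, hv⟩ := tendsto_integral_and_variance hA hB hl
  -- Finite combinations are Gaussian; their characteristic function formula passes to the limit
  -- because mean and variance converge too.
  have hgauss : ∀ n, ∫ ω, Complex.exp (linComb U (l n) ω * Complex.I) ∂P =
      Complex.exp ((∫ ω, linComb U (l n) ω ∂P : ℝ) * Complex.I - Var[linComb U (l n); P] / 2) := by
    intro n
    have hlaw : HasGaussianLaw (linComb U (l n)) P :=
      (hG.smul fun t => l n t).hasGaussianLaw_fun_sum (I := (l n).support)
    have h := hlaw.charFunDual_map_eq_fun (ContinuousLinearMap.id ℝ ℝ)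
    rw [charFunDual_apply, integral_map hlaw.aemeasurable (by fun_prop)] at h
    simpa using h
  refine tendsto_nhds_unique h1 ?_
  simp_rw [hgauss]
  refine (Complex.continuous_exp.tendsto _).comp ?_
  refine Tendsto.sub ?_ ?_
  · exact ((Complex.continuous_ofReal.tendsto _).comp hm).mul_const _
  · exact ((Complex.continuous_ofReal.tendsto _).comp hv).div_const _

/-- Identically distributed processes have identically distributed integrals. -/
lemma identDistrib_integral [IsProbabilityMeasure P] [CompleteSpace E] {U V : ℝ → Ω → ℝ}
    {c d : ℝ≥0} (hU : LinearGrowth U P c) (hV : LinearGrowth V P d)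
    (hUV : IdentDistrib (fun ω t => U t ω) (fun ω t => V t ω) P P) {f : ℝ → E}
    (hf : WeightedIntegrable f) :
    IdentDistrib (fun ω => ∫ s, U s ω • f s) (fun ω => ∫ s, V s ω • f s) P P := by
  have hUm := (stronglyMeasurable_integral_smul hU.measurable hf.measurable).measurable
  have hVm := (stronglyMeasurable_integral_smul hV.measurable hf.measurable).measurable
  refine ⟨hUm.aemeasurable, hVm.aemeasurable, ?_⟩
  have := Measure.isProbabilityMeasure_map (μ := P) hUm.aemeasurable
  have := Measure.isProbabilityMeasure_map (μ := P) hVm.aemeasurable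
  refine Measure.ext_of_charFunDual (funext fun L => ?_)
  rw [charFunDual_map_integral hU hf L, charFunDual_map_integral hV hf L]
  have hLf := hf.clm_comp L
  have hi1 : Measurable fun ω : Ω => (ω, true) := by fun_prop
  have hi2 : Measurable fun ω : Ω => (ω, false) := by fun_prop
  -- Both processes are glued on two disjoint copies of Ω, so that a single sequence of coefficients
  -- approximates both integrals at once.
  set Q : Measure (Ω × Bool) := P.map (fun ω => (ω, true)) + P.map (fun ω => (ω, false)) with hQ
  set W : ℝ → Ω × Bool → ℝ := fun t x => if x.2 = true then U t x.1 else V t x.1 with hW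
  have hWm : Measurable (Function.uncurry W) := by
    refine Measurable.ite (measurableSet_eq_fun (by fun_prop) measurable_const) ?_ ?_
    · exact hU.measurable.comp (by fun_prop : Measurable fun q : ℝ × Ω × Bool => (q.1, q.2.1))
    · exact hV.measurable.comp (by fun_prop : Measurable fun q : ℝ × Ω × Bool => (q.1, q.2.1))
  have hWg : LinearGrowth W Q (c + d) := by
    refine ⟨hWm, fun s => ?_⟩
    have hWs : Measurable fun x => ‖W s x‖ₑ ^ 2 :=
      ((hWm.comp (by fun_prop : Measurable fun x : Ω × Bool => (s, x))).enorm.pow_const 2)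
    rw [hQ, lintegral_add_measure, lintegral_map hWs hi1, lintegral_map hWs hi2]
    simp only [hW, if_true, Bool.false_eq_true, if_false]
    refine (add_le_add (hU.bound s) (hV.bound s)).trans ?_
    rw [ENNReal.coe_add, add_mul]
    set a := (c : ℝ≥0∞) * ENNReal.ofReal (1 + |s|)
    set b := (d : ℝ≥0∞) * ENNReal.ofReal (1 + |s|)
    calc a ^ 2 + b ^ 2 ≤ a ^ 2 + b ^ 2 + 2 * a * b := le_self_add
      _ = (a + b) ^ 2 := by ring
  obtain ⟨l, hl⟩ := hWg.exists_tendsto_linComb hLf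
  have hUl : Tendsto (fun n => eLpNorm (linComb U (l n) - fun ω => ∫ s, U s ω • L (f s)) 2 P)
      atTop (𝓝 0) := by
    refine tendsto_of_tendsto_of_tendsto_of_le_of_le tendsto_const_nhds hl (fun n => zero_le)
      fun n => ?_
    have hm := (hWg.memLp_linComb (l n)).sub (hWg.memLp_integral hLf)
    calc _ = eLpNorm (linComb W (l n) - fun x => ∫ s, W s x • L (f s)) 2
          (P.map fun ω => (ω, true)) := by
          rw [eLpNorm_map_measure (hm.1.mono_measure (Measure.le_add_right le_rfl)) hi1.aemeasurable]
          rfl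
      _ ≤ _ := eLpNorm_mono_measure _ (Measure.le_add_right le_rfl)
  have hVl : Tendsto (fun n => eLpNorm (linComb V (l n) - fun ω => ∫ s, V s ω • L (f s)) 2 P)
      atTop (𝓝 0) := by
    refine tendsto_of_tendsto_of_tendsto_of_le_of_le tendsto_const_nhds hl (fun n => zero_le)
      fun n => ?_
    have hm := (hWg.memLp_linComb (l n)).sub (hWg.memLp_integral hLf)
    calc _ = eLpNorm (linComb W (l n) - fun x => ∫ s, W s x • L (f s)) 2
          (P.map fun ω => (ω, false)) := by
          rw [eLpNorm_map_measure (hm.1.mono_measure (Measure.le_add_left le_rfl)) hi2.aemeasurable]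
          rfl
      _ ≤ _ := eLpNorm_mono_measure _ (Measure.le_add_left le_rfl)
  refine tendsto_nhds_unique (tendsto_integral_cexp (hU.memLp_integral hLf)
    (fun n => hU.memLp_linComb (l n)) hUl) ?_
  refine (tendsto_integral_cexp (hV.memLp_integral hLf)
    (fun n => hV.memLp_linComb (l n)) hVl).congr fun n => ?_
  have hmeas : Measurable fun x : ℝ → ℝ =>
      Complex.exp (((l n).sum fun t a => a * x t : ℝ) * Complex.I) := by
    simp only [Finsupp.sum]
    fun_prop
  exact (hUV.comp hmeas).integral_eq.symm

end IntegralsOfPaths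

/-! ### Linear growth of the increments. -/

/-- A measurable even subadditive function on the line grows at most linearly. -/
lemma exists_linear_bound_of_subadditive {v : ℝ → ℝ} (hv : Measurable v)
    (hneg : ∀ t, v (-t) = v t) (hadd : ∀ s t, v (s + t) ≤ v s + v t) :
    ∃ c : ℝ≥0, ∀ t, v t ≤ c * (1 + |t|) := by
  obtain ⟨n, hn⟩ : ∃ n : ℕ, volume ({t | v t ≤ n} : Set ℝ) ≠ 0 := by
    by_contra! hcon
    have h1 : volume (⋃ n : ℕ, {t | v t ≤ n}) = 0 := measure_iUnion_null hcon
    have h2 : (⋃ n : ℕ, {t | v t ≤ n}) = univ := by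
      ext t
      simpa using exists_nat_ge (v t)
    rw [h2] at h1
    simp at h1
  -- Steinhaus: the difference set of a set of positive measure is a neighbourhood of 0. Evenness
  -- and subadditivity bound v on it by 2n.
  have hnhds : {t | v t ≤ n} - {t | v t ≤ n} ∈ 𝓝 (0 : ℝ) :=
    Measure.sub_mem_nhds_zero_of_addHaar_pos volume _ (measurableSet_le hv measurable_const)
      (pos_iff_ne_zero.2 hn)
  obtain ⟨δ, hδ, hball⟩ := Metric.mem_nhds_iff.1 hnhds
  have hsmall : ∀ t, |t| < δ → v t ≤ 2 * n := by
    intro t ht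
    obtain ⟨a, ha, b, hb, rfl⟩ := hball (show t ∈ Metric.ball 0 δ by simpa using ht)
    have := hadd a (-b)
    rw [hneg] at this
    simp only [mem_ofPred_eq] at ha hb
    rw [← sub_eq_add_neg] at this
    dsimp only
    linarith
  -- Multiples start at 1 because v 0 ≤ 0 is not available.
  have hmul : ∀ (k : ℕ) (t : ℝ), v ((k + 1 : ℕ) * t) ≤ (k + 1 : ℕ) * v t := by
    intro k t
    induction k with
    | zero => simp
    | succ k ih =>
      have := hadd ((k + 1 : ℕ) * t) t
      calc v ((k + 1 + 1 : ℕ) * t) = v ((k + 1 : ℕ) * t + t) := by congr 1; push_cast; ring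
        _ ≤ (k + 1 : ℕ) * v t + v t := by linarith
        _ = _ := by push_cast; ring
  have hb : ∀ t, v t ≤ (|t| / δ + 2) * (2 * n) := by
    intro t
    set k := ⌊|t| / δ⌋₊
    have hk : |t| / δ < k + 1 := Nat.lt_floor_add_one _
    have hk' : (k : ℝ) ≤ |t| / δ := Nat.floor_le (by positivity)
    have hpos : (0 : ℝ) < ((k + 1 : ℕ) : ℝ) := by positivity
    have h1 := hmul k (t / (k + 1 : ℕ))
    rw [mul_div_cancel₀ _ hpos.ne'] at h1
    have h2 : v (t / (k + 1 : ℕ)) ≤ 2 * n := by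
      apply hsmall
      rw [abs_div, abs_of_pos hpos, div_lt_iff₀ hpos]
      rw [div_lt_iff₀ hδ] at hk
      push_cast
      linarith
    calc v t ≤ (k + 1 : ℕ) * (2 * n) := h1.trans (by gcongr)
      _ ≤ _ := by
        gcongr
        push_cast
        linarith
  refine ⟨⟨(1 / δ + 2) * (2 * n), by positivity⟩, fun t => (hb t).trans ?_⟩
  change _ ≤ (1 / δ + 2) * (2 * n) * (1 + |t|)
  have : (|t| / δ + 2) ≤ (1 / δ + 2) * (1 + |t|) := by
    have h1 : 0 ≤ 1 / δ := by positivity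
    have : |t| / δ = 1 / δ * |t| := by ring
    rw [this]
    nlinarith [abs_nonneg t]
  calc _ ≤ ((1 / δ + 2) * (1 + |t|)) * (2 * n) := by gcongr
    _ = _ := by ring

lemma measurable_increment {X : ℝ → Ω → ℝ} (hX : Measurable (Function.uncurry X))
    {a b : ℝ → ℝ} (ha : Measurable a) (hb : Measurable b) :
    Measurable (Function.uncurry fun t ω => X (a t) ω - X (b t) ω) := by
  have h1 := hX.comp (by fun_prop : Measurable fun q : ℝ × Ω => (a q.1, q.2))
  have h2 := hX.comp (by fun_prop : Measurable fun q : ℝ × Ω => (b q.1, q.2))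
  exact h1.sub h2

lemma HasStationaryIncrements.identDistrib_sub {X : ℝ → Ω → ℝ}
    (hXs : HasStationaryIncrements X P) (s t : ℝ) :
    IdentDistrib (fun ω => X t ω - X s ω) (fun ω => X (t - s) ω - X 0 ω) P P := by
  have h := (hXs s).comp (measurable_pi_apply (t - s))
  simpa [Function.comp_def] using h

/-- The L² norm of an increment depends only on its length; as a function of the length it is
measurable, even, and subadditive by Minkowski. -/
lemma HasStationaryIncrements.exists_bound [IsProbabilityMeasure P] {X : ℝ → Ω → ℝ}
    (hX : Measurable (Function.uncurry X))
    (hX2 : ∀ s t : ℝ, MemLp (fun ω => X t ω - X s ω) 2 P)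
    (hXs : HasStationaryIncrements X P) :
    ∃ c : ℝ≥0, ∀ s t, eLpNorm (fun ω => X t ω - X s ω) 2 P ≤
      c * ENNReal.ofReal (1 + |t - s|) := by
  set v : ℝ → ℝ := fun t => (eLpNorm (fun ω => X t ω - X 0 ω) 2 P).toReal with hv
  have hst : ∀ s t, (eLpNorm (fun ω => X t ω - X s ω) 2 P).toReal = v (t - s) := fun s t => by
    rw [(hXs.identDistrib_sub s t).eLpNorm_eq]
  have hvm : Measurable v := by
    have hm : Measurable fun t => eLpNorm (fun ω => X t ω - X 0 ω) 2 P := by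
      simp_rw [eLpNorm_eq_lintegral_rpow_enorm_toReal (p := 2) (by simp) (by simp)]
      apply Measurable.pow_const
      apply Measurable.lintegral_prod_right'
        (f := fun q : ℝ × Ω => ‖X q.1 q.2 - X 0 q.2‖ₑ ^ (2 : ℝ≥0∞).toReal)
      exact (measurable_increment hX measurable_id measurable_const).enorm.pow_const _
    exact hm.ennreal_toReal
  obtain ⟨c, hc⟩ := exists_linear_bound_of_subadditive hvm
    (fun t => by
      have h1 := hst t 0
      rw [zero_sub] at h1
      rw [← h1, hv]
      simp only
      congr 1
      rw [← eLpNorm_neg]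
      congr 1
      ext ω
      simp)
    (fun s t => by
      have h1 := hst s (s + t)
      rw [add_sub_cancel_left] at h1
      rw [← h1, ← ENNReal.toReal_add (hX2 0 s).2.ne (hX2 s (s + t)).2.ne]
      refine ENNReal.toReal_mono (by simp [(hX2 0 s).2.ne, (hX2 s (s + t)).2.ne]) ?_
      have := eLpNorm_add_le (hX2 0 s).1 (hX2 s (s + t)).1 (p := 2) one_le_two
      refine le_trans (le_of_eq ?_) this
      congr 1
      ext ω
      simp)
  refine ⟨c, fun s t => ?_⟩
  rw [← ENNReal.ofReal_toReal (hX2 s t).2.ne, hst, ← ENNReal.ofReal_coe_nnreal,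
    ← ENNReal.ofReal_mul c.coe_nonneg]
  exact ENNReal.ofReal_le_ofReal (hc _)

lemma linearGrowth_of_eLpNorm_le {U : ℝ → Ω → ℝ} {c : ℝ≥0} (hm : Measurable (Function.uncurry U))
    (h : ∀ s, eLpNorm (U s) 2 P ≤ c * ENNReal.ofReal (1 + |s|)) : LinearGrowth U P c := by
  refine ⟨hm, fun s => ?_⟩
  have h1 := eLpNorm_nnreal_pow_eq_lintegral (f := U s) (μ := P) (p := 2) (by norm_num)
  have h2 : ∫⁻ ω, ‖U s ω‖ₑ ^ 2 ∂P = eLpNorm (U s) 2 P ^ 2 := by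
    simpa using h1.symm
  rw [h2]
  gcongr
  exact h s

/-! ### Fourier uniqueness, Hermitian symmetry and correlations. -/

lemma fourier_eq_angularFourier (f : ℝ → ℂ) (w : ℝ) :
    𝓕 f w = angularFourier f (2 * Real.pi * w) := by
  rw [Real.fourier_real_eq_integral_exp_smul, angularFourier]
  refine integral_congr_ae (ae_of_all _ fun t => ?_)
  simp only [smul_eq_mul]
  rw [mul_comm]
  congr 2
  push_cast
  ring

/-- The Fourier transform is injective on integrable functions. -/
lemma ae_eq_zero_of_angularFourier_eq_zero {h : ℝ → ℂ} (hh : Integrable h)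
    (hz : ∀ ω, angularFourier h ω = 0) : ∀ᵐ t, h t = 0 := by
  refine ae_eq_zero_of_integral_contDiff_smul_eq_zero hh.locallyIntegrable fun g hg hgs => ?_
  have hgs' : HasCompactSupport fun x => (g x : ℂ) := hgs.comp_left (g := Complex.ofReal) (by simp)
  set G : 𝓢(ℝ, ℂ) := hgs'.toSchwartzMap (Complex.ofRealCLM.contDiff.comp hg) with hG
  have hGx : ∀ x, G x = g x := fun x => rfl
  set k : 𝓢(ℝ, ℂ) := 𝓕⁻ G with hk
  have hFk : 𝓕 (k : ℝ → ℂ) = G := by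
    rw [← SchwartzMap.fourier_coe, hk, FourierTransform.fourier_fourierInv_eq]
  -- The test function g is the transform of a Schwartz function k, so the multiplication formula ∫
  -- ĥ k = ∫ h k̂ gives ∫ h g = 0.
  have key := VectorFourier.integral_fourierIntegral_smul_eq_flip (L := innerₗ ℝ)
      (μ := volume) (ν := volume) Real.continuous_fourierChar continuous_inner hh k.integrable
  have h1 : ∀ ξ, VectorFourier.fourierIntegral Real.fourierChar volume (innerₗ ℝ) h ξ = 0 :=
    fun ξ => by
      have := fourier_eq_angularFourier h ξ
      rw [hz] at this
      exact this
  have h2 : ∀ x, VectorFourier.fourierIntegral Real.fourierChar volume (innerₗ ℝ).flip k x = g x :=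
    fun x => by
      rw [flip_innerₗ]
      have := congrFun hFk x
      rw [hGx] at this
      exact this
  simp only [h1, h2, zero_smul, integral_zero] at key
  rw [key]
  refine integral_congr_ae (ae_of_all _ fun x => ?_)
  simp [mul_comm]

lemma integrable_mul_cexp {f : ℝ → ℂ} (hf : Integrable f) (ω : ℝ) :
    Integrable fun t : ℝ => f t * Complex.exp (-(Complex.I * (ω : ℂ) * (t : ℂ))) := by
  refine hf.mul_bdd (c := 1) (by fun_prop : Continuous _).aestronglyMeasurable
    (ae_of_all _ fun t => ?_)
  have : -(Complex.I * (ω : ℂ) * (t : ℂ)) = ((-(ω * t) : ℝ) : ℂ) * Complex.I := by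
    push_cast
    ring
  rw [this, Complex.norm_exp_ofReal_mul_I]

lemma conj_cexp_neg_I_mul (ω t : ℝ) :
    conj (Complex.exp (-(Complex.I * (ω : ℂ) * (t : ℂ)))) =
      Complex.exp (-(Complex.I * ((-ω : ℝ) : ℂ) * (t : ℂ))) := by
  rw [← Complex.exp_conj]
  congr 1
  simp

lemma angularFourier_conj (f : ℝ → ℂ) (ω : ℝ) :
    angularFourier (fun t => conj (f t)) ω = conj (angularFourier f (-ω)) := by
  simp only [angularFourier, ← integral_conj]
  refine integral_congr_ae (ae_of_all _ fun t => ?_)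
  simp only [map_mul, conj_cexp_neg_I_mul, neg_neg]

lemma angularFourier_comp_neg (f : ℝ → ℂ) (ω : ℝ) :
    angularFourier (fun t => f (-t)) ω = angularFourier f (-ω) := by
  simp only [angularFourier]
  rw [← integral_neg_eq_self]
  refine integral_congr_ae (ae_of_all _ fun t => ?_)
  simp

lemma angularFourier_comp_sub_left (f : ℝ → ℂ) (u ω : ℝ) :
    angularFourier (fun t => f (u - t)) ω =
      Complex.exp (-(Complex.I * ω * u)) * angularFourier f (-ω) := by
  simp only [angularFourier]
  rw [← integral_sub_left_eq_self _ volume u, ← integral_const_mul]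
  refine integral_congr_ae (ae_of_all _ fun t => ?_)
  simp only [sub_sub_cancel]
  rw [mul_left_comm, ← Complex.exp_add]
  congr 2
  push_cast
  ring

/-- An integrable function with a real Fourier transform is Hermitian. -/
lemma ae_comp_neg_eq_conj {f : ℝ → ℂ} (hf : Integrable f)
    (hr : ∀ ω, (angularFourier f ω).im = 0) : ∀ᵐ t, f (-t) = conj (f t) := by
  have h1 : Integrable fun t => f (-t) := hf.comp_neg
  have h2 : Integrable fun t => conj (f t) :=
    (Complex.conjLIE.toContinuousLinearEquiv.toContinuousLinearMap.integrable_comp hf :)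
  have := ae_eq_zero_of_angularFourier_eq_zero (h1.sub h2) fun ω => by
    have : angularFourier ((fun t => f (-t)) - fun t => conj (f t)) ω =
        angularFourier (fun t => f (-t)) ω - angularFourier (fun t => conj (f t)) ω := by
      simp only [angularFourier, Pi.sub_apply, sub_mul]
      exact integral_sub (integrable_mul_cexp h1 ω) (integrable_mul_cexp h2 ω)
    rw [this, angularFourier_comp_neg, angularFourier_conj, Complex.conj_eq_iff_im.2 (hr _), sub_self]
  filter_upwards [this] with t ht
  exact sub_eq_zero.1 ht

lemma integrable_correlation_kernel {f g : ℝ → ℂ} (hf : Integrable f) (hg : Integrable g) :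
    Integrable (fun z : ℝ × ℝ => f (z.1 + z.2) * g z.2) (volume.prod volume) :=
  (measurePreserving_add_prod volume volume).integrable_comp_of_integrable (hf.mul_prod hg)

/-- If `f̂(ω) ĝ(-ω) = 0` for all `ω`, the correlation of `f` and `g` vanishes. -/
lemma ae_correlation_eq_zero {f g : ℝ → ℂ} (hf : Integrable f) (hg : Integrable g)
    (h : ∀ ω, angularFourier f ω * angularFourier g (-ω) = 0) :
    ∀ᵐ w, ∫ r, f (w + r) * g r = 0 := by
  have hi := integrable_correlation_kernel hf hg
  -- By Fubini the transform of the correlation factors as f̂(ω) ĝ(-ω).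
  refine ae_eq_zero_of_angularFourier_eq_zero hi.integral_prod_left fun ω => ?_
  have hi' : Integrable (fun z : ℝ × ℝ =>
      f (z.1 + z.2) * g z.2 * Complex.exp (-(Complex.I * ω * z.1))) (volume.prod volume) := by
    refine hi.mul_bdd (c := 1) (by fun_prop : Continuous _).aestronglyMeasurable
      (ae_of_all _ fun z => ?_)
    have : -(Complex.I * (ω : ℂ) * (z.1 : ℂ)) = ((-(ω * z.1) : ℝ) : ℂ) * Complex.I := by
      push_cast
      ring
    rw [this, Complex.norm_exp_ofReal_mul_I]
  have hin : ∀ r : ℝ, ∫ w, f (w + r) * g r * Complex.exp (-(Complex.I * ω * w)) =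
      angularFourier f ω * (g r * Complex.exp (-(Complex.I * ((-ω : ℝ) : ℂ) * r))) := by
    intro r
    rw [angularFourier, ← integral_mul_const, ← integral_sub_right_eq_self _ r]
    refine integral_congr_ae (ae_of_all _ fun w => ?_)
    simp only [sub_add_cancel]
    rw [mul_mul_mul_comm, ← Complex.exp_add]
    congr 2
    push_cast
    ring
  calc angularFourier (fun w => ∫ r, f (w + r) * g r) ω
      = ∫ w, ∫ r, f (w + r) * g r * Complex.exp (-(Complex.I * ω * w)) := by
        simp only [angularFourier, ← integral_mul_const]
    _ = ∫ r, ∫ w, f (w + r) * g r * Complex.exp (-(Complex.I * ω * w)) :=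
        integral_integral_swap hi'
    _ = angularFourier f ω * angularFourier g (-ω) := by
        simp_rw [hin]
        rw [integral_const_mul, angularFourier, angularFourier]
    _ = 0 := h ω

/-! ### Variogram kernels tested against functions of zero mean. -/

/-- The damped variogram `γ(t) / (1 + ε |t|)`. -/
noncomputable def damp (γ : ℝ → ℝ) (ε t : ℝ) : ℝ := γ t / (1 + ε * |t|)

/-- Damping turns quadratic growth into linear growth, at the price of a constant that blows up with
1/ε. -/
lemma abs_damp_le {γ : ℝ → ℝ} {c ε : ℝ} (hc : 0 ≤ c) (hε : 0 < ε) (hε1 : ε ≤ 1)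
    (hγ : ∀ t, |γ t| ≤ c * (1 + |t|) ^ 2) (t : ℝ) : |damp γ ε t| ≤ c / ε * (1 + |t|) := by
  have hd : 0 < 1 + ε * |t| := by positivity
  rw [damp, abs_div, abs_of_pos hd, div_le_iff₀ hd]
  refine (hγ t).trans ?_
  rw [div_mul_eq_mul_div, div_mul_eq_mul_div, le_div_iff₀ hε]
  have h1 : ε * (1 + |t|) ≤ 1 + ε * |t| := by linarith
  calc c * (1 + |t|) ^ 2 * ε = c * (1 + |t|) * (ε * (1 + |t|)) := by ring
    _ ≤ c * (1 + |t|) * (1 + ε * |t|) := by gcongr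

/-- The point is uniformity in ε: although γ is quadratic, the damped kernel keeps the product bound
of the undamped one, as domination requires. -/
lemma abs_damp_increment_le_of_le {γ : ℝ → ℝ} {c ε : ℝ} (hc : 0 ≤ c) (hε : 0 < ε) (hε1 : ε ≤ 1)
    (hγ : ∀ t, |γ t| ≤ c * (1 + |t|) ^ 2) {s r : ℝ}
    (hC : |γ s + γ r - γ (s - r)| ≤ c * ((1 + |s|) * (1 + |r|))) (hrs : |r| ≤ |s|) :
    |damp γ ε s + damp γ ε r - damp γ ε (s - r)| ≤ 4 * c * ((1 + |s|) * (1 + |r|)) := by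
  set a := 1 + ε * |s| with ha
  set b := 1 + ε * |r| with hb
  set d := 1 + ε * |s - r| with hd
  have ha1 : 1 ≤ a := by have : 0 ≤ ε * |s| := by positivity
                         linarith
  have hb1 : 1 ≤ b := by have : 0 ≤ ε * |r| := by positivity
                         linarith
  have hd1 : 1 ≤ d := by have : 0 ≤ ε * |s - r| := by positivity
                         linarith
  have hba : b ≤ a := by have : ε * |r| ≤ ε * |s| := by gcongr
                         linarith
  -- All three terms are brought to the damping factor 1/a. The errors are controlled by |r| ≤ |s|
  -- and by | |s-r| - |s| | ≤ |r|; the three bounds carry constants c, c and 2c.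
  have hsplit : damp γ ε s + damp γ ε r - damp γ ε (s - r) =
      (γ s + γ r - γ (s - r)) / a + γ r * (1 / b - 1 / a) + γ (s - r) * ((d - a) / (a * d)) := by
    simp only [damp, ← ha, ← hb, ← hd]
    field_simp
    ring
  have h1 : |(γ s + γ r - γ (s - r)) / a| ≤ c * ((1 + |s|) * (1 + |r|)) := by
    rw [abs_div, abs_of_pos (by linarith : 0 < a)]
    exact (div_le_self (abs_nonneg _) ha1).trans hC
  have h2 : |γ r * (1 / b - 1 / a)| ≤ c * ((1 + |s|) * (1 + |r|)) := by
    have hle : |1 / b - 1 / a| ≤ 1 := by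
      have e1 : 1 / a ≤ 1 / b := one_div_le_one_div_of_le (by linarith) hba
      have e2 : 1 / b ≤ 1 := by rw [div_le_one (by linarith)]; exact hb1
      have e3 : 0 < 1 / a := by positivity
      rw [abs_of_nonneg (by linarith)]
      linarith
    rw [abs_mul]
    calc |γ r| * |1 / b - 1 / a| ≤ (c * (1 + |r|) ^ 2) * 1 := by gcongr; exact hγ r
      _ = c * ((1 + |r|) * (1 + |r|)) := by ring
      _ ≤ _ := by gcongr
  have h3 : |γ (s - r) * ((d - a) / (a * d))| ≤ 2 * c * ((1 + |s|) * (1 + |r|)) := by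
    have hda : |d - a| ≤ ε * |r| := by
      have : d - a = ε * (|s - r| - |s|) := by rw [hd, ha]; ring
      rw [this, abs_mul, abs_of_pos hε]
      have := abs_abs_sub_abs_le_abs_sub (s - r) s
      rw [sub_sub_cancel_left, abs_neg] at this
      exact mul_le_mul_of_nonneg_left this hε.le
    rw [abs_mul, abs_div, abs_of_pos (by positivity : 0 < a * d), mul_div_assoc',
      div_le_iff₀ (by positivity)]
    have hsr : |s - r| ≤ |s| + |r| := abs_sub s r
    have e1 : ε * (1 + |s - r|) ≤ d := by rw [hd]; linarith
    calc |γ (s - r)| * |d - a| ≤ (c * (1 + |s - r|) ^ 2) * (ε * |r|) := by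
          gcongr; exact hγ _
      _ = c * |r| * (1 + |s - r|) * (ε * (1 + |s - r|)) := by ring
      _ ≤ c * (1 + |r|) * (2 * (1 + |s|)) * d := by
          have : 1 + |s - r| ≤ 2 * (1 + |s|) := by linarith [abs_nonneg s]
          have : |r| ≤ 1 + |r| := by linarith
          gcongr
      _ = 2 * c * ((1 + |s|) * (1 + |r|)) * (1 * d) := by ring
      _ ≤ 2 * c * ((1 + |s|) * (1 + |r|)) * (a * d) := by gcongr
  rw [hsplit]
  refine (abs_add_le _ _).trans ?_
  have := abs_add_le ((γ s + γ r - γ (s - r)) / a) (γ r * (1 / b - 1 / a))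
  linarith

lemma abs_damp_increment_le {γ : ℝ → ℝ} {c ε : ℝ} (hc : 0 ≤ c) (hε : 0 < ε) (hε1 : ε ≤ 1)
    (hγ : ∀ t, |γ t| ≤ c * (1 + |t|) ^ 2) (heven : ∀ t, γ (-t) = γ t)
    (hC : ∀ s r, |γ s + γ r - γ (s - r)| ≤ c * ((1 + |s|) * (1 + |r|))) (s r : ℝ) :
    |damp γ ε s + damp γ ε r - damp γ ε (s - r)| ≤ 4 * c * ((1 + |s|) * (1 + |r|)) := by
  rcases le_total |r| |s| with h | h
  · exact abs_damp_increment_le_of_le hc hε hε1 hγ (hC s r) h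
  · have h1 := abs_damp_increment_le_of_le hc hε hε1 hγ (hC r s) h
    have h2 : damp γ ε (r - s) = damp γ ε (s - r) := by
      simp only [damp]
      rw [← neg_sub, heven, abs_neg]
    rw [h2] at h1
    rw [add_comm (damp γ ε s), mul_comm (1 + |s|)]
    exact h1

lemma WeightedIntegrable.integrable_prod_weight {f g : ℝ → ℂ} (hf : WeightedIntegrable f)
    (hg : WeightedIntegrable g) :
    Integrable fun p : ℝ × ℝ => (1 + |p.1|) * (1 + |p.2|) * ‖f p.1 * g p.2‖ := by
  refine (hf.integrable_weight.mul_prod hg.integrable_weight).congr (ae_of_all _ fun p => ?_)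
  simp only [norm_mul]
  ring

lemma WeightedIntegrable.integrable_kernel_mul {f g : ℝ → ℂ} (hf : WeightedIntegrable f)
    (hg : WeightedIntegrable g) {κ : ℝ × ℝ → ℝ} (hκ : Measurable κ) {c : ℝ}
    (hb : ∀ s r, |κ (s, r)| ≤ c * ((1 + |s|) * (1 + |r|))) :
    Integrable fun p : ℝ × ℝ => (κ p : ℂ) * (f p.1 * g p.2) := by
  have hfm := hf.measurable
  have hgm := hg.measurable
  refine ((hf.integrable_prod_weight hg).const_mul c).mono ?_ (ae_of_all _ fun p => ?_)
  · exact (by fun_prop : Measurable fun p : ℝ × ℝ =>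
      (κ p : ℂ) * (f p.1 * g p.2)).aestronglyMeasurable
  · have h0 : 0 ≤ c * ((1 + |p.1|) * (1 + |p.2|)) := (abs_nonneg _).trans (hb p.1 p.2)
    rw [norm_mul, Complex.norm_real, Real.norm_eq_abs, ← mul_assoc, norm_mul (c * _), norm_norm,
      Real.norm_of_nonneg h0]
    exact mul_le_mul_of_nonneg_right (hb p.1 p.2) (norm_nonneg _)

/-- Under linear growth the three terms are separately integrable. The first two vanish by the zero
means of g and f; in the third, the substitution w = s - r isolates the correlation. -/
lemma integral_damp_increment_eq_zero {γ : ℝ → ℝ} (hγm : Measurable γ) {c : ℝ}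
    (hγ : ∀ t, |γ t| ≤ c * (1 + |t|)) {f g : ℝ → ℂ} (hf : WeightedIntegrable f)
    (hg : WeightedIntegrable g) (hf0 : ∫ s, f s = 0) (hg0 : ∫ s, g s = 0)
    (hcorr : ∀ᵐ w, ∫ r, f (w + r) * g r = 0) :
    ∫ p : ℝ × ℝ, ((γ p.1 + γ p.2 - γ (p.1 - p.2) : ℝ) : ℂ) * (f p.1 * g p.2) = 0 := by
  have hc : 0 ≤ c := by simpa using (abs_nonneg _).trans (hγ 0)
  have hb1 : ∀ s r : ℝ, |γ s| ≤ c * ((1 + |s|) * (1 + |r|)) := fun s r =>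
    (hγ s).trans (by
      gcongr
      exact le_mul_of_one_le_right (one_add_abs_pos s).le (by linarith [abs_nonneg r]))
  have hb2 : ∀ s r : ℝ, |γ (s - r)| ≤ c * ((1 + |s|) * (1 + |r|)) := fun s r =>
    (hγ _).trans (by
      gcongr
      nlinarith [abs_sub s r, abs_nonneg s, abs_nonneg r, mul_nonneg (abs_nonneg s) (abs_nonneg r)])
  have i1 := hf.integrable_kernel_mul hg (κ := fun p => γ p.1) (by fun_prop) hb1
  have i2 := hf.integrable_kernel_mul hg (κ := fun p => γ p.2) (by fun_prop)
    (fun s r => by rw [mul_comm (1 + |s|)]; exact hb1 r s)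
  have i3 := hf.integrable_kernel_mul hg (κ := fun p => γ (p.1 - p.2)) (by fun_prop) hb2
  have e1 : ∫ p : ℝ × ℝ, (γ p.1 : ℂ) * (f p.1 * g p.2) = 0 := by
    have := integral_prod_mul (μ := (volume : Measure ℝ)) (ν := (volume : Measure ℝ))
      (fun s => (γ s : ℂ) * f s) g
    rw [hg0, mul_zero] at this
    rw [← this]
    exact integral_congr_ae (ae_of_all _ fun p => by simp only; ring)
  have e2 : ∫ p : ℝ × ℝ, (γ p.2 : ℂ) * (f p.1 * g p.2) = 0 := by
    have := integral_prod_mul (μ := (volume : Measure ℝ)) (ν := (volume : Measure ℝ))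
      f (fun s => (γ s : ℂ) * g s)
    rw [hf0, zero_mul] at this
    rw [← this]
    exact integral_congr_ae (ae_of_all _ fun p => by simp only; ring)
  have e3 : ∫ p : ℝ × ℝ, (γ (p.1 - p.2) : ℂ) * (f p.1 * g p.2) = 0 := by
    have hmp := measurePreserving_add_prod (volume : Measure ℝ) (volume : Measure ℝ)
    have i3' := hmp.integrable_comp_of_integrable i3
    have hmap := integral_map hmp.measurable.aemeasurable
      (f := fun p : ℝ × ℝ => (γ (p.1 - p.2) : ℂ) * (f p.1 * g p.2)) (by rw [hmp.map_eq]; exact i3.1)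
    rw [hmp.map_eq] at hmap
    rw [Measure.volume_eq_prod, hmap]
    refine (integral_prod _ i3').trans ?_
    refine integral_eq_zero_of_ae ?_
    filter_upwards [hcorr] with w hw
    simp only [add_sub_cancel_right, Function.comp_def, Pi.zero_apply]
    rw [integral_const_mul, hw, mul_zero]
  have : ∀ p : ℝ × ℝ, ((γ p.1 + γ p.2 - γ (p.1 - p.2) : ℝ) : ℂ) * (f p.1 * g p.2) =
      (γ p.1 : ℂ) * (f p.1 * g p.2) + (γ p.2 : ℂ) * (f p.1 * g p.2)
        - (γ (p.1 - p.2) : ℂ) * (f p.1 * g p.2) := fun p => by push_cast; ring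
  simp_rw [this]
  rw [integral_sub (by exact i1.add i2) i3, integral_add i1 i2, e1, e2, e3]
  simp

/-- A kernel of the form `γ(s) + γ(r) - γ(s - r)` annihilates pairs of functions of vanishing
correlation. -/
lemma integral_increment_kernel_eq_zero {γ : ℝ → ℝ} (hγm : Measurable γ) {c : ℝ}
    (hγ : ∀ t, |γ t| ≤ c * (1 + |t|) ^ 2) (heven : ∀ t, γ (-t) = γ t)
    (hC : ∀ s r, |γ s + γ r - γ (s - r)| ≤ c * ((1 + |s|) * (1 + |r|)))
    {f g : ℝ → ℂ} (hf : WeightedIntegrable f)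
    (hg : WeightedIntegrable g) (hf0 : ∫ s, f s = 0) (hg0 : ∫ s, g s = 0)
    (hcorr : ∀ᵐ w, ∫ r, f (w + r) * g r = 0) :
    ∫ p : ℝ × ℝ, ((γ p.1 + γ p.2 - γ (p.1 - p.2) : ℝ) : ℂ) * (f p.1 * g p.2) = 0 := by
  have hc : 0 ≤ c := by simpa using (abs_nonneg _).trans (hγ 0)
  have hfm := hf.measurable
  have hgm := hg.measurable
  -- With only first moments of f and g, a quadratic γ need not be integrable term by term. The
  -- identity holds for each damped γ and passes to the limit by dominated convergence.
  set ε : ℕ → ℝ := fun n => 1 / (n + 1 : ℝ) with hεdef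
  have hε : ∀ n, 0 < ε n := fun n => by positivity
  have hε1 : ∀ n, ε n ≤ 1 := fun n => by
    rw [hεdef]
    simp only
    rw [div_le_one (by positivity)]
    linarith [(Nat.cast_nonneg n : (0 : ℝ) ≤ n)]
  have hεlim : Tendsto ε atTop (𝓝 0) := tendsto_one_div_add_atTop_nhds_zero_nat
  have hdm : ∀ n, Measurable (damp γ (ε n)) := fun n =>
    hγm.div (by fun_prop : Measurable fun t : ℝ => 1 + ε n * |t|)
  have hlim : ∀ t, Tendsto (fun n => damp γ (ε n) t) atTop (𝓝 (γ t)) := fun t => by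
    have h1 : Tendsto (fun n => 1 + ε n * |t|) atTop (𝓝 (1 + 0 * |t|)) :=
      (hεlim.mul_const _).const_add _
    have h2 := (tendsto_const_nhds (x := γ t)).div h1 (by simp)
    simpa [damp, Pi.div_def] using h2
  have hz : ∀ n, ∫ p : ℝ × ℝ, ((damp γ (ε n) p.1 + damp γ (ε n) p.2 - damp γ (ε n) (p.1 - p.2) : ℝ)
      : ℂ) * (f p.1 * g p.2) = 0 := fun n =>
    integral_damp_increment_eq_zero (hdm n) (abs_damp_le hc (hε n) (hε1 n) hγ) hf hg hf0 hg0 hcorr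
  have hconv := tendsto_integral_of_dominated_convergence
    (F := fun n (p : ℝ × ℝ) => ((damp γ (ε n) p.1 + damp γ (ε n) p.2 - damp γ (ε n) (p.1 - p.2) : ℝ)
      : ℂ) * (f p.1 * g p.2))
    (f := fun p : ℝ × ℝ => ((γ p.1 + γ p.2 - γ (p.1 - p.2) : ℝ) : ℂ) * (f p.1 * g p.2))
    (fun p : ℝ × ℝ => 4 * c * ((1 + |p.1|) * (1 + |p.2|) * ‖f p.1 * g p.2‖))
    (fun n => by
      have := hdm n
      exact (by fun_prop : Measurable fun p : ℝ × ℝ =>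
        ((damp γ (ε n) p.1 + damp γ (ε n) p.2 - damp γ (ε n) (p.1 - p.2) : ℝ) : ℂ)
          * (f p.1 * g p.2)).aestronglyMeasurable)
    ((hf.integrable_prod_weight hg).const_mul _)
    (fun n => ae_of_all _ fun p => by
      rw [norm_mul, Complex.norm_real, Real.norm_eq_abs, ← mul_assoc]
      gcongr
      exact abs_damp_increment_le hc (hε n) (hε1 n) hγ heven hC p.1 p.2)
    (ae_of_all _ fun p => by
      refine Tendsto.mul_const _ ?_
      exact (Complex.continuous_ofReal.tendsto _).comp
        (((hlim p.1).add (hlim p.2)).sub (hlim (p.1 - p.2))))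
  simp_rw [hz] at hconv
  exact tendsto_nhds_unique hconv tendsto_const_nhds

/-! ### Dilated wavelets and wavelet transforms of paths. -/

lemma WeightedIntegrable.conj {f : ℝ → ℂ} (hf : WeightedIntegrable f) :
    WeightedIntegrable (fun s => conj (f s)) :=
  ⟨Complex.continuous_conj.measurable.comp hf.measurable, by simpa using hf.integrable_weight⟩

lemma weightedNorm_comp_sub_left_le {f : ℝ → ℂ} (hf : Measurable f) (u : ℝ) :
    weightedNorm (fun s => f (u - s)) ≤ ENNReal.ofReal (1 + |u|) * weightedNorm f := by
  unfold weightedNorm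
  rw [← lintegral_const_mul _ (by fun_prop),
    ← lintegral_sub_left_eq_self (fun s => ENNReal.ofReal (1 + |u|) * _) u]
  refine lintegral_mono fun s => ?_
  rw [← mul_assoc, ← ENNReal.ofReal_mul (one_add_abs_pos u).le]
  gcongr
  have h : |s| ≤ |u| + |u - s| := by simpa using abs_sub u (u - s)
  nlinarith [abs_nonneg u, abs_nonneg (u - s), mul_nonneg (abs_nonneg u) (abs_nonneg (u - s))]

lemma WeightedIntegrable.comp_sub_left {f : ℝ → ℂ} (hf : WeightedIntegrable f) (u : ℝ) :
    WeightedIntegrable (fun s => f (u - s)) :=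
  .of_lt_top (hf.measurable.comp (by fun_prop)) <|
    (weightedNorm_comp_sub_left_le hf.measurable u).trans_lt
      (ENNReal.mul_lt_top ENNReal.ofReal_lt_top hf.weightedNorm_lt_top)

lemma IsWavelet.weightedIntegrable_dilate {ψ : ℝ → ℂ} (hψ : IsWavelet ψ) (j : ℤ) :
    WeightedIntegrable (dilate ψ j) := by
  have hψm := hψ.measurable
  have ha : (0 : ℝ) < 2 ^ (-j) := by positivity
  set a : ℝ := 2 ^ (-j) with hadef
  have hm : Measurable (dilate ψ j) := by unfold dilate; fun_prop
  -- The factor comes from 1 + |t| ≤ (1 + a⁻¹)(1 + |a t|).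
  have h := (hψ.decay.comp_mul_left' ha.ne').const_mul (a * (1 + a⁻¹))
  refine ⟨hm, h.mono ?_ (ae_of_all _ fun t => ?_)⟩
  · exact ((by fun_prop : Measurable fun s : ℝ => 1 + |s|).mul hm.norm).aestronglyMeasurable
  · have hpos : 0 ≤ 1 + |a * t| := by positivity
    simp only [dilate, norm_mul, norm_norm, Complex.norm_real, ← hadef]
    rw [Real.norm_of_nonneg (one_add_abs_pos t).le, Real.norm_of_nonneg ha.le,
      Real.norm_of_nonneg hpos, Real.norm_of_nonneg (by positivity : 0 ≤ 1 + a⁻¹)]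
    have h1 : 1 + |t| ≤ (1 + a⁻¹) * (1 + |a * t|) := by
      rw [abs_mul, abs_of_pos ha]
      have : a⁻¹ * (a * |t|) = |t| := by field_simp
      have h2 : 0 ≤ a * |t| := by positivity
      have h3 : 0 ≤ a⁻¹ := by positivity
      nlinarith
    calc (1 + |t|) * (a * ‖ψ (a * t)‖) ≤ ((1 + a⁻¹) * (1 + |a * t|)) * (a * ‖ψ (a * t)‖) := by
          gcongr
      _ = _ := by ring

lemma angularFourier_dilate (ψ : ℝ → ℂ) (j : ℤ) (ω : ℝ) :
    angularFourier (dilate ψ j) ω = angularFourier ψ (2 ^ j * ω) := by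
  have ha : (0 : ℝ) < 2 ^ (-j) := by positivity
  have hinv : ((2 : ℝ) ^ j) * 2 ^ (-j) = 1 := by
    rw [← zpow_add₀ (by norm_num)]; simp
  have h := Measure.integral_comp_mul_left
    (fun t : ℝ => ψ t * Complex.exp (-(Complex.I * ((2 ^ j * ω : ℝ) : ℂ) * (t : ℂ)))) (2 ^ (-j))
  rw [abs_of_pos (inv_pos.2 ha)] at h
  have h' : angularFourier ψ (2 ^ j * ω) = ((2 : ℝ) ^ (-j)) • ∫ t : ℝ, ψ (2 ^ (-j) * t) *
      Complex.exp (-(Complex.I * ((2 ^ j * ω : ℝ) : ℂ) * ((2 ^ (-j) * t : ℝ) : ℂ))) := by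
    rw [h, smul_smul, mul_inv_cancel₀ ha.ne', one_smul]
    rfl
  rw [h', angularFourier, ← integral_smul]
  refine integral_congr_ae (ae_of_all _ fun t => ?_)
  have he : ((2 ^ j * ω : ℝ) : ℂ) * ((2 ^ (-j) * t : ℝ) : ℂ) = (ω : ℂ) * t := by
    rw [← Complex.ofReal_mul, mul_mul_mul_comm, hinv, one_mul, Complex.ofReal_mul]
  simp only [dilate, Complex.real_smul]
  rw [mul_assoc Complex.I ((2 ^ j * ω : ℝ) : ℂ), he, mul_assoc Complex.I (ω : ℂ), mul_assoc]

lemma IsWavelet.integral_dilate {ψ : ℝ → ℂ} (hψ : IsWavelet ψ) (j : ℤ) :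
    ∫ t, dilate ψ j t = 0 := by
  have h := angularFourier_dilate ψ j 0
  simp only [angularFourier, mul_zero, Complex.ofReal_zero, zero_mul, neg_zero, Complex.exp_zero,
    mul_one, hψ.zero_average] at h
  exact h

lemma IsWavelet.ae_dilate_neg {ψ : ℝ → ℂ} (hψ : IsWavelet ψ) (j : ℤ) :
    ∀ᵐ t, dilate ψ j (-t) = conj (dilate ψ j t) :=
  ae_comp_neg_eq_conj (hψ.weightedIntegrable_dilate j).integrable fun ω => by
    rw [angularFourier_dilate]
    exact hψ.real_fourier _

lemma waveletTransform_eq (ψ : ℝ → ℂ) (x : ℝ → ℝ) (j : ℤ) (t : ℝ) :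
    waveletTransform ψ x j t = ∫ s, x s • dilate ψ j (t - s) := rfl

lemma convolutionExistsAt_iff (ψ : ℝ → ℂ) (x : ℝ → ℝ) (j : ℤ) (t : ℝ) :
    ConvolutionExistsAt x (dilate ψ j) t (ContinuousLinearMap.lsmul ℝ ℝ) volume ↔
      Integrable fun s => x s • dilate ψ j (t - s) := Iff.rfl

lemma IsWavelet.integrable_sub_const_iff {ψ : ℝ → ℂ} (hψ : IsWavelet ψ) (x : ℝ → ℝ) (k : ℝ)
    (j : ℤ) (t : ℝ) :
    Integrable (fun s => (x s - k) • dilate ψ j (t - s)) ↔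
      Integrable (fun s => x s • dilate ψ j (t - s)) := by
  have hk : Integrable fun s => k • dilate ψ j (t - s) :=
    ((hψ.weightedIntegrable_dilate j).comp_sub_left t).integrable.smul k
  constructor
  · intro h
    refine (h.add hk).congr (ae_of_all _ fun s => ?_)
    simp [sub_smul]
  · intro h
    refine (h.sub hk).congr (ae_of_all _ fun s => ?_)
    simp [sub_smul]

lemma IsWavelet.integral_dilate_sub_left {ψ : ℝ → ℂ} (hψ : IsWavelet ψ) (j : ℤ) (t : ℝ) :
    ∫ s, dilate ψ j (t - s) = 0 := by
  rw [integral_sub_left_eq_self (dilate ψ j) volume t, hψ.integral_dilate]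

/-- Wavelet transforms do not see constants. -/
lemma IsWavelet.waveletTransform_sub_const {ψ : ℝ → ℂ} (hψ : IsWavelet ψ) (x : ℝ → ℝ) (k : ℝ)
    (j : ℤ) : waveletTransform ψ (fun s => x s - k) j = waveletTransform ψ x j := by
  ext t
  simp only [waveletTransform_eq]
  by_cases h : Integrable fun s => x s • dilate ψ j (t - s)
  · have hk : Integrable fun s => k • dilate ψ j (t - s) :=
      ((hψ.weightedIntegrable_dilate j).comp_sub_left t).integrable.smul k
    simp_rw [sub_smul]
    rw [integral_sub h hk, integral_smul, hψ.integral_dilate_sub_left]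
    simp
  -- If one integral diverges so does the other, and both take the default value 0; the identity
  -- thus holds for every path.
  · rw [integral_undef h, integral_undef (mt (hψ.integrable_sub_const_iff x k j t).1 h)]

lemma waveletTransform_shift (ψ : ℝ → ℂ) (x : ℝ → ℝ) (j : ℤ) (h t : ℝ) :
    waveletTransform ψ (fun s => x (s + h)) j t = waveletTransform ψ x j (t + h) := by
  simp only [waveletTransform_eq]
  rw [← integral_add_right_eq_self (fun s => x s • dilate ψ j (t + h - s)) h]
  simp

lemma IsWavelet.waveletTransform_reverse {ψ : ℝ → ℂ} (hψ : IsWavelet ψ) (x : ℝ → ℝ) (j : ℤ)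
    (t : ℝ) : waveletTransform ψ (fun s => x (-s)) j t = conj (waveletTransform ψ x j (-t)) := by
  simp only [waveletTransform_eq]
  rw [← integral_neg_eq_self, ← integral_conj]
  refine integral_congr_ae ?_
  have hq : ∀ᵐ s : ℝ, dilate ψ j (-(-t - s)) = conj (dilate ψ j (-t - s)) :=
    (quasiMeasurePreserving_sub_left volume (-t)).ae (hψ.ae_dilate_neg j)
  filter_upwards [hq] with s hs
  simp only [neg_neg, Complex.real_smul, map_mul, Complex.conj_ofReal]
  rw [← hs]
  congr 2
  ring

/-- Linear growth is stable under U ↦ |U⋆ψ_j|, since translating the wavelet by t costs a factor 1 +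
|t|. The second layer therefore obeys the same estimates as the first. -/
lemma LinearGrowth.waveletModulus [SFinite P] {U : ℝ → Ω → ℝ} {c : ℝ≥0} (hU : LinearGrowth U P c)
    {ψ : ℝ → ℂ} (hψ : IsWavelet ψ) (j : ℤ) :
    LinearGrowth (fun t ω => Scattering.waveletModulus ψ (fun u => U u ω) j t) P
      (c * (weightedNorm (dilate ψ j)).toNNReal) := by
  have hw := hψ.weightedIntegrable_dilate j
  have hd := hw.measurable
  constructor
  · exact (measurable_integral_smul (f := fun t s => dilate ψ j (t - s)) hU.measurable
      (hd.comp (by fun_prop : Measurable fun q : ℝ × ℝ => q.1 - q.2))).measurable.norm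
  · intro t
    have h := hU.lintegral_enorm_integral_sq_le (f := fun s => dilate ψ j (t - s))
      (hd.comp (by fun_prop))
    simp only [Scattering.waveletModulus, enorm_norm, waveletTransform_eq]
    refine h.trans (pow_le_pow_left₀ zero_le ?_ 2)
    rw [ENNReal.coe_mul, ENNReal.coe_toNNReal hw.weightedNorm_lt_top.ne, mul_assoc]
    gcongr
    rw [mul_comm]
    exact weightedNorm_comp_sub_left_le hd t

/-- A process whose increments from time `0` have linear growth has well-defined wavelet and
scattering transforms. -/
lemma isWellDefined_of_linearGrowth [SFinite P] {X : ℝ → Ω → ℝ} {c : ℝ≥0}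
    (hZ : LinearGrowth (fun t ω => X t ω - X 0 ω) P c) {ψ : ℝ → ℂ} (hψ : IsWavelet ψ) :
    IsWellDefined ψ X P := by
  have hYX : ∀ (ω : Ω) (j : ℤ), Scattering.waveletTransform ψ (fun u => X u ω) j =
      Scattering.waveletTransform ψ (fun u => X u ω - X 0 ω) j := fun ω j =>
    (hψ.waveletTransform_sub_const _ _ j).symm
  refine ⟨fun j t => ⟨?_, ?_⟩, fun j k t => ⟨?_, ?_⟩⟩
  · filter_upwards [hZ.ae_integrable ((hψ.weightedIntegrable_dilate j).comp_sub_left t)] with ω hω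
    rw [convolutionExistsAt_iff]
    exact (hψ.integrable_sub_const_iff _ _ _ _).1 hω
  · simp_rw [hYX]
    exact hZ.memLp_integral ((hψ.weightedIntegrable_dilate j).comp_sub_left t)
  · filter_upwards [(hZ.waveletModulus hψ j).ae_integrable
      ((hψ.weightedIntegrable_dilate k).comp_sub_left t)] with ω hω
    rw [convolutionExistsAt_iff]
    simp only [Scattering.waveletModulus, hYX]
    exact hω
  · have hMX : ∀ ω, Scattering.waveletModulus ψ (fun u => X u ω) j =
        Scattering.waveletModulus ψ (fun u => X u ω - X 0 ω) j := fun ω => by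
      ext s
      simp only [Scattering.waveletModulus, hYX]
    simp only [scatteringTransform, hMX]
    exact (hZ.waveletModulus hψ j).memLp_integral
      ((hψ.weightedIntegrable_dilate k).comp_sub_left t)

/-! ### Mixed moments of wavelet moduli. -/

/-- The mixed moment `E |X ⋆ ψ_j(p)| |X ⋆ ψ_l(q)|`. -/
noncomputable def modulusMoment (ψ : ℝ → ℂ) (X : ℝ → Ω → ℝ) (P : Measure Ω) (j l : ℤ)
    (p q : ℝ) : ℝ :=
  ∫ ω, waveletModulus ψ (fun u => X u ω) j p * waveletModulus ψ (fun u => X u ω) l q ∂P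

lemma modulusMoment_sub {ψ : ℝ → ℂ} (hψ : IsWavelet ψ) (X : ℝ → Ω → ℝ) (P : Measure Ω) (j l : ℤ)
    (k : Ω → ℝ) (p q : ℝ) :
    modulusMoment ψ (fun t ω => X t ω - k ω) P j l p q = modulusMoment ψ X P j l p q := by
  simp only [modulusMoment, waveletModulus, hψ.waveletTransform_sub_const]

/-- The numerator of the scattering cross-spectrum in terms of mixed moments. -/
lemma integral_scattering_mul_conj [SFinite P] {X : ℝ → Ω → ℝ} {c : ℝ≥0}
    (hZ : LinearGrowth (fun t ω => X t ω - X 0 ω) P c) {ψ : ℝ → ℂ} (hψ : IsWavelet ψ)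
    (j l k : ℤ) (t : ℝ) :
    ∫ ω, scatteringTransform ψ (fun u => X u ω) j k t *
        conj (scatteringTransform ψ (fun u => X u ω) l k t) ∂P =
      ∫ p : ℝ × ℝ, (modulusMoment ψ X P j l p.1 p.2 : ℂ) *
        (dilate ψ k (t - p.1) * conj (dilate ψ k (t - p.2))) := by
  have hw := (hψ.weightedIntegrable_dilate k).comp_sub_left t
  have h := (hZ.waveletModulus hψ j).integral_mul_integral (hZ.waveletModulus hψ l) hw hw.conj
  simp only [modulusMoment]
  simp only [waveletModulus, hψ.waveletTransform_sub_const] at h ⊢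
  rw [← h]
  refine integral_congr_ae (ae_of_all _ fun ω => ?_)
  simp only [scatteringTransform]
  rw [waveletTransform_eq, waveletTransform_eq, ← integral_conj]
  congr 1
  refine integral_congr_ae (ae_of_all _ fun s => ?_)
  simp [waveletModulus]

lemma WeightedIntegrable.prodMk {f g : ℝ → ℂ} (hf : WeightedIntegrable f)
    (hg : WeightedIntegrable g) : WeightedIntegrable (fun s => (f s, g s)) := by
  have hm := hf.measurable.prodMk hg.measurable
  refine ⟨hm, (hf.integrable_weight.add hg.integrable_weight).mono ?_ (ae_of_all _ fun s => ?_)⟩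
  · exact ((by fun_prop : Measurable fun s : ℝ => 1 + |s|).mul hm.norm).aestronglyMeasurable
  · have h1 := one_add_abs_pos s
    simp only [Pi.add_apply]
    rw [Real.norm_of_nonneg (by positivity), Real.norm_of_nonneg (by positivity), ← mul_add]
    gcongr
    rw [Prod.norm_mk]
    exact max_le_add_of_nonneg (norm_nonneg _) (norm_nonneg _)

lemma LinearGrowth.integral_prodMk_ae_eq [SFinite P] {U : ℝ → Ω → ℝ} {c : ℝ≥0}
    (hU : LinearGrowth U P c) {f g : ℝ → ℂ} (hf : WeightedIntegrable f)
    (hg : WeightedIntegrable g) :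
    (fun ω => ∫ s, U s ω • (f s, g s)) =ᵐ[P]
      fun ω => (∫ s, U s ω • f s, ∫ s, U s ω • g s) := by
  filter_upwards [hU.ae_integrable hf, hU.ae_integrable hg] with ω h1 h2
  simp only [Prod.smul_mk]
  exact integral_pair h1 h2

/-- Pairing f and g into one ℂ × ℂ-valued integrand yields equality of joint laws. -/
lemma identDistrib_integral_prodMk [IsProbabilityMeasure P] {U V : ℝ → Ω → ℝ}
    {c d : ℝ≥0} (hU : LinearGrowth U P c) (hV : LinearGrowth V P d)
    (hUV : IdentDistrib (fun ω t => U t ω) (fun ω t => V t ω) P P) {f g : ℝ → ℂ}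
    (hf : WeightedIntegrable f) (hg : WeightedIntegrable g) :
    IdentDistrib (fun ω => (∫ s, U s ω • f s, ∫ s, U s ω • g s))
      (fun ω => (∫ s, V s ω • f s, ∫ s, V s ω • g s)) P P := by
  have h := identDistrib_integral hU hV hUV (hf.prodMk hg)
  have e1 := hU.integral_prodMk_ae_eq hf hg
  have e2 := hV.integral_prodMk_ae_eq hf hg
  refine ⟨h.aemeasurable_fst.congr e1, h.aemeasurable_snd.congr e2, ?_⟩
  rw [← Measure.map_congr e1, ← Measure.map_congr e2, h.map_eq]

lemma modulusMoment_eq_of_identDistrib [IsProbabilityMeasure P] {U V : ℝ → Ω → ℝ}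
    {c d : ℝ≥0} (hU : LinearGrowth U P c) (hV : LinearGrowth V P d)
    (hUV : IdentDistrib (fun ω t => U t ω) (fun ω t => V t ω) P P) {ψ : ℝ → ℂ}
    (hψ : IsWavelet ψ) (j l : ℤ) (p q : ℝ) :
    modulusMoment ψ U P j l p q = modulusMoment ψ V P j l p q := by
  have h := identDistrib_integral_prodMk hU hV hUV
    ((hψ.weightedIntegrable_dilate j).comp_sub_left p)
    ((hψ.weightedIntegrable_dilate l).comp_sub_left q)
  exact (h.comp (by fun_prop : Measurable fun z : ℂ × ℂ => ‖z.1‖ * ‖z.2‖)).integral_eq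

lemma modulusMoment_reverse {ψ : ℝ → ℂ} (hψ : IsWavelet ψ) (X : ℝ → Ω → ℝ) (P : Measure Ω)
    (j l : ℤ) (p q : ℝ) :
    modulusMoment ψ (fun t ω => X (-t) ω) P j l p q = modulusMoment ψ X P j l (-p) (-q) := by
  simp only [modulusMoment, waveletModulus]
  refine integral_congr_ae (ae_of_all _ fun ω => ?_)
  simp only
  rw [hψ.waveletTransform_reverse (fun s => X s ω), hψ.waveletTransform_reverse (fun s => X s ω),
    RCLike.norm_conj, RCLike.norm_conj]

lemma modulusMoment_shift (ψ : ℝ → ℂ) (X : ℝ → Ω → ℝ) (P : Measure Ω)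
    (j l : ℤ) (h p q : ℝ) :
    modulusMoment ψ (fun t ω => X (t + h) ω) P j l p q =
      modulusMoment ψ X P j l (p + h) (q + h) := by
  simp only [modulusMoment, waveletModulus]
  refine integral_congr_ae (ae_of_all _ fun ω => ?_)
  simp only
  rw [waveletTransform_shift ψ (fun s => X s ω), waveletTransform_shift ψ (fun s => X s ω)]

/-! ### Covariances of path integrals and independence. -/

lemma LinearGrowth.variance_le [IsProbabilityMeasure P] {U : ℝ → Ω → ℝ} {c : ℝ≥0}
    (hU : LinearGrowth U P c) (t : ℝ) : Var[U t; P] ≤ (c * (1 + |t|)) ^ 2 := by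
  have hm := hU.memLp_eval t
  refine (variance_le_expectation_sq hm.1).trans ?_
  have h1 : P[(U t) ^ 2] = (∫⁻ ω, ‖U t ω‖ₑ ^ 2 ∂P).toReal := by
    rw [integral_eq_lintegral_of_nonneg_ae (ae_of_all _ fun ω => by simp [sq_nonneg])
      (hm.1.pow 2)]
    congr 1
    refine lintegral_congr fun ω => ?_
    rw [Pi.pow_apply, ← sq_abs, ENNReal.ofReal_pow (abs_nonneg _), Real.enorm_eq_ofReal_abs]
  rw [h1]
  refine ENNReal.toReal_le_of_le_ofReal (by positivity) ((hU.bound t).trans (le_of_eq ?_))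
  rw [ENNReal.ofReal_pow (by positivity), ENNReal.ofReal_mul (by positivity),
    ENNReal.ofReal_coe_nnreal]

lemma LinearGrowth.abs_covariance_le [IsProbabilityMeasure P] {U : ℝ → Ω → ℝ} {c : ℝ≥0}
    (hU : LinearGrowth U P c) (s r : ℝ) :
    |cov[U s, U r; P]| ≤ c ^ 2 * ((1 + |s|) * (1 + |r|)) := by
  have hs := hU.variance_le s
  have hr := hU.variance_le r
  have hws := one_add_abs_pos s
  have hwr := one_add_abs_pos r
  have key : ∀ a : ℝ, 2 * a * cov[U s, U r; P] ≤ Var[U s; P] + a ^ 2 * Var[U r; P] := fun a => by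
    have h := variance_nonneg (U s - a • U r) P
    rw [variance_sub (hU.memLp_eval s) ((hU.memLp_eval r).const_smul a), variance_smul,
      covariance_smul_right] at h
    linarith
  -- This ratio balances the bounds on the two variances, so the inequality for ±a gives the product
  -- bound.
  set a : ℝ := (1 + |s|) / (1 + |r|) with ha
  have hapos : 0 < a := by positivity
  have hsum : Var[U s; P] + a ^ 2 * Var[U r; P] ≤ 2 * a * (c ^ 2 * ((1 + |s|) * (1 + |r|))) := by
    calc _ ≤ (c * (1 + |s|)) ^ 2 + a ^ 2 * (c * (1 + |r|)) ^ 2 := by gcongr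
      _ = _ := by
        rw [ha]
        field_simp
        ring
  have h1 := key a
  have h2 := key (-a)
  rw [neg_sq] at h2
  have h2a : 0 < 2 * a := by positivity
  rw [abs_le]
  constructor
  · refine le_of_mul_le_mul_left ?_ h2a
    linarith
  · refine le_of_mul_le_mul_left ?_ h2a
    linarith

lemma LinearGrowth.mean [IsProbabilityMeasure P] {U : ℝ → Ω → ℝ} {c : ℝ≥0}
    (hU : LinearGrowth U P c) : LinearGrowth (fun t (_ : Ω) => ∫ ω, U t ω ∂P) P c := by
  have hm : Measurable fun t => ∫ ω, U t ω ∂P :=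
    (hU.measurable.stronglyMeasurable.integral_prod_right (ν := P)).measurable
  refine ⟨hm.comp measurable_fst, fun s => ?_⟩
  refine le_trans ?_ (hU.bound s)
  rw [lintegral_const, measure_univ, mul_one]
  have hUs : Measurable (U s) :=
    hU.measurable.comp (by fun_prop : Measurable fun ω : Ω => (s, ω))
  calc ‖∫ ω, U s ω ∂P‖ₑ ^ 2 ≤ (∫⁻ ω, ‖U s ω‖ₑ * 1 ∂P) ^ 2 := by
        gcongr
        simpa using enorm_integral_le_lintegral_enorm (μ := P) (U s)
    _ ≤ (∫⁻ ω, ‖U s ω‖ₑ ^ 2 * 1 ∂P) * ∫⁻ _, 1 ∂P :=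
        sq_lintegral_mul_le hUs.enorm measurable_const
    _ = _ := by simp

lemma LinearGrowth.integral_integral [IsProbabilityMeasure P] {U : ℝ → Ω → ℝ} {c : ℝ≥0}
    (hU : LinearGrowth U P c) {f : ℝ → ℂ} (hf : WeightedIntegrable f) :
    ∫ ω, (∫ s, U s ω • f s) ∂P = ∫ s, (∫ ω, U s ω ∂P) • f s := by
  have h1 : LinearGrowth (fun _ (_ : Ω) => (1 : ℝ)) P 1 := by
    refine ⟨measurable_const, fun s => ?_⟩
    simp only [enorm_one, one_pow, lintegral_const, measure_univ, mul_one, ENNReal.coe_one, one_mul]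
    refine one_le_pow₀ ?_
    rw [← ENNReal.ofReal_one]
    exact ENNReal.ofReal_le_ofReal (by linarith [abs_nonneg s])
  have h := hU.integral_mul_integral h1 hf weightedIntegrable_indicator_Ioc
  have hone : ∫ r : ℝ, (Ioc (0 : ℝ) 1).indicator (fun _ => (1 : ℂ)) r = 1 := by
    rw [integral_indicator measurableSet_Ioc]
    simp
  simp only [one_smul, hone, mul_one] at h
  rw [h]
  have h2 := integral_prod_mul (μ := (volume : Measure ℝ)) (ν := (volume : Measure ℝ))
    (fun s => (∫ ω, U s ω ∂P) • f s) ((Ioc (0 : ℝ) 1).indicator (fun _ => (1 : ℂ)))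
  rw [hone, mul_one] at h2
  rw [← h2]
  refine integral_congr_ae (ae_of_all _ fun p => ?_)
  simp only [Complex.real_smul]
  ring

/-- The covariance of two integrals of a process. -/
lemma LinearGrowth.covariance_integral [IsProbabilityMeasure P] {U : ℝ → Ω → ℝ} {c : ℝ≥0}
    (hU : LinearGrowth U P c) {φ χ : ℝ → ℝ} (hφ : WeightedIntegrable φ)
    (hχ : WeightedIntegrable χ) :
    ((cov[fun ω => ∫ s, U s ω • φ s, fun ω => ∫ s, U s ω • χ s; P] : ℝ) : ℂ) =
      ∫ p : ℝ × ℝ, ((cov[U p.1, U p.2; P] : ℝ) : ℂ) * ((φ p.1 : ℂ) * (χ p.2 : ℂ)) := by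
  have hφc := hφ.ofReal
  have hχc := hχ.ofReal
  have hcast : ∀ (x χ : ℝ → ℝ), ((∫ s, x s • χ s : ℝ) : ℂ) = ∫ s, x s • (χ s : ℂ) :=
    fun x χ => by
      rw [← integral_complex_ofReal]
      exact integral_congr_ae (ae_of_all _ fun s => by simp)
  have e1 := hU.integral_mul_integral hU hφc hχc
  -- The mean is itself a deterministic process of linear growth, so the product of means obeys the
  -- same formula.
  have e2 := hU.mean.integral_mul_integral hU.mean hφc hχc
  have i1 := hU.integrable_moment_kernel hU hφc hχc
  have i2 := hU.mean.integrable_moment_kernel hU.mean hφc hχc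
  simp only [integral_const, probReal_univ, one_smul] at e2 i2
  rw [covariance_eq_sub (hU.memLp_integral hφ) (hU.memLp_integral hχ)]
  simp_rw [fun p : ℝ × ℝ => covariance_eq_sub (hU.memLp_eval p.1) (hU.memLp_eval p.2)]
  simp only [Pi.mul_apply, Complex.ofReal_sub, sub_mul]
  rw [integral_sub i1 i2, ← e1, ← e2, ← hU.integral_integral hφc, ← hU.integral_integral hχc]
  simp only [← hcast, ← Complex.ofReal_mul, integral_complex_ofReal]

lemma covariance_congr_ae {A A' B B' : Ω → ℝ} (hA : A =ᵐ[P] A') (hB : B =ᵐ[P] B') :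
    cov[A, B; P] = cov[A', B'; P] := by
  rw [covariance, covariance, integral_congr_ae hA, integral_congr_ae hB]
  refine integral_congr_ae ?_
  filter_upwards [hA, hB] with ω h1 h2
  rw [h1, h2]

/-- Polarization: the variance of X(s) - X(r) depends only on s - r. -/
lemma increment_kernel_eq [IsProbabilityMeasure P] {X : ℝ → Ω → ℝ}
    (hX2 : ∀ s t : ℝ, MemLp (fun ω => X t ω - X s ω) 2 P)
    (hXs : HasStationaryIncrements X P) (s r : ℝ) :
    2 * cov[fun ω => X s ω - X 0 ω, fun ω => X r ω - X 0 ω; P] =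
      Var[fun ω => X s ω - X 0 ω; P] + Var[fun ω => X r ω - X 0 ω; P]
        - Var[fun ω => X (s - r) ω - X 0 ω; P] := by
  have h := variance_sub (hX2 0 s) (hX2 0 r)
  rw [← (hXs.identDistrib_sub r s).variance_eq]
  have h' : ((fun ω => X s ω - X 0 ω) - fun ω => X r ω - X 0 ω) = fun ω => X s ω - X r ω := by
    ext ω
    simp
  rw [h'] at h
  linarith

/-- A real functional on ℂ has the form z ↦ a z + b z̄, and conjugating f reflects its spectrum. -/
lemma angularFourier_ofReal_clm_comp {f : ℝ → ℂ} (hf : Integrable f) (L : StrongDual ℝ ℂ) :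
    ∃ a b : ℂ, ∀ ω, angularFourier (fun s => (L (f s) : ℂ)) ω =
      a * angularFourier f ω + b * conj (angularFourier f (-ω)) := by
  refine ⟨(L 1 - Complex.I * L Complex.I) / 2, (L 1 + Complex.I * L Complex.I) / 2, fun ω => ?_⟩
  have hfc : Integrable fun s => conj (f s) :=
    Complex.conjLIE.toContinuousLinearEquiv.toContinuousLinearMap.integrable_comp hf
  rw [← angularFourier_conj]
  simp only [angularFourier]
  rw [← integral_const_mul, ← integral_const_mul, ← integral_add
    ((integrable_mul_cexp hf ω).const_mul _) ((integrable_mul_cexp hfc ω).const_mul _)]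
  refine integral_congr_ae (ae_of_all _ fun s => ?_)
  simp only
  rw [← mul_assoc, ← mul_assoc, ← add_mul]
  congr 1
  have hL : L (f s) = (f s).re * L 1 + (f s).im * L Complex.I := by
    have : f s = (f s).re • (1 : ℂ) + (f s).im • Complex.I := by
      simp [Complex.re_add_im]
    conv_lhs => rw [this]
    rw [map_add, map_smul, map_smul, smul_eq_mul, smul_eq_mul]
  rw [hL]
  apply Complex.ext <;> simp <;> ring

/-- Integrals of a process with stationary increments against functions of disjoint spectra are
uncorrelated. -/
lemma covariance_integral_eq_zero [IsProbabilityMeasure P] {X : ℝ → Ω → ℝ} {c : ℝ≥0}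
    (hX2 : ∀ s t : ℝ, MemLp (fun ω => X t ω - X s ω) 2 P)
    (hXs : HasStationaryIncrements X P)
    (hZ : LinearGrowth (fun t ω => X t ω - X 0 ω) P c) {φ χ : ℝ → ℝ}
    (hφ : WeightedIntegrable φ) (hχ : WeightedIntegrable χ)
    (hφ0 : ∫ s, φ s = 0) (hχ0 : ∫ s, χ s = 0)
    (h : ∀ ω, angularFourier (fun s => (φ s : ℂ)) ω * angularFourier (fun s => (χ s : ℂ)) (-ω) = 0) :
    cov[fun ω => ∫ s, (X s ω - X 0 ω) • φ s, fun ω => ∫ s, (X s ω - X 0 ω) • χ s; P] = 0 := by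
  set γ : ℝ → ℝ := fun t => Var[fun ω => X t ω - X 0 ω; P] with hγ
  have hker := increment_kernel_eq hX2 hXs
  have hγm : Measurable γ := by
    have h1 : ∀ t, γ t = ∫ ω, (X t ω - X 0 ω) ^ 2 ∂P - (∫ ω, X t ω - X 0 ω ∂P) ^ 2 := fun t =>
      variance_eq_sub (hX2 0 t)
    rw [funext h1]
    have h2 : Measurable fun t => ∫ ω, (X t ω - X 0 ω) ^ 2 ∂P :=
      ((hZ.measurable.pow_const 2).stronglyMeasurable.integral_prod_right' (ν := P)).measurable
    have h3 : Measurable fun t => ∫ ω, X t ω - X 0 ω ∂P :=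
      (hZ.measurable.stronglyMeasurable.integral_prod_right' (ν := P)).measurable
    exact h2.sub (h3.pow_const 2)
  have hb : ∀ t, |γ t| ≤ 2 * (c : ℝ) ^ 2 * (1 + |t|) ^ 2 := fun t => by
    rw [abs_of_nonneg (variance_nonneg _ _)]
    refine (hZ.variance_le t).trans ?_
    have : 0 ≤ (c : ℝ) ^ 2 * (1 + |t|) ^ 2 := by positivity
    rw [mul_pow]
    linarith
  have heven : ∀ t, γ (-t) = γ t := fun t => by
    have h1 := (hXs.identDistrib_sub t 0).variance_eq
    rw [zero_sub] at h1
    simp only [hγ]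
    rw [← h1, ← variance_neg]
    congr 1
    ext ω
    simp
  have hC : ∀ s r, |γ s + γ r - γ (s - r)| ≤ 2 * (c : ℝ) ^ 2 * ((1 + |s|) * (1 + |r|)) :=
    fun s r => by
      rw [hγ, ← hker s r, abs_mul, abs_of_pos (two_pos), mul_assoc]
      gcongr
      exact hZ.abs_covariance_le s r
  have hcorr := ae_correlation_eq_zero hφ.ofReal.integrable hχ.ofReal.integrable h
  have hz := integral_increment_kernel_eq_zero hγm hb heven hC hφ.ofReal hχ.ofReal
    (by rw [integral_complex_ofReal, hφ0, Complex.ofReal_zero])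
    (by rw [integral_complex_ofReal, hχ0, Complex.ofReal_zero]) hcorr
  have hcov := hZ.covariance_integral hφ hχ
  have hrw : ∀ p : ℝ × ℝ, ((cov[fun ω => X p.1 ω - X 0 ω, fun ω => X p.2 ω - X 0 ω; P] : ℝ) : ℂ) *
      ((φ p.1 : ℂ) * (χ p.2 : ℂ)) = (1 / 2 : ℂ) *
        (((γ p.1 + γ p.2 - γ (p.1 - p.2) : ℝ) : ℂ) * ((φ p.1 : ℂ) * (χ p.2 : ℂ))) := fun p => by
    rw [hγ, ← hker]
    push_cast
    ring
  simp_rw [hrw] at hcov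
  rw [integral_const_mul, hz, mul_zero] at hcov
  exact_mod_cast hcov

/-- Wavelet coefficients of a Gaussian process at scales with disjoint spectra are independent. -/
lemma indepFun_integral [IsProbabilityMeasure P] {X : ℝ → Ω → ℝ} {c : ℝ≥0}
    (hX2 : ∀ s t : ℝ, MemLp (fun ω => X t ω - X s ω) 2 P)
    (hXs : HasStationaryIncrements X P) (hG : IsGaussianProcess X P)
    (hZ : LinearGrowth (fun t ω => X t ω - X 0 ω) P c) {f g : ℝ → ℂ}
    (hf : WeightedIntegrable f) (hg : WeightedIntegrable g)
    (hf0 : ∫ s, f s = 0) (hg0 : ∫ s, g s = 0)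
    (h1 : ∀ ω, angularFourier f ω * angularFourier g (-ω) = 0)
    (h2 : ∀ ω, angularFourier f ω * angularFourier g ω = 0) :
    IndepFun (fun ω => ∫ s, (X s ω - X 0 ω) • f s) (fun ω => ∫ s, (X s ω - X 0 ω) • g s) P := by
  have hGZ : IsGaussianProcess (fun t ω => X t ω - X 0 ω) P := by
    simpa using hG.shift 0
  have hlaw := (hasGaussianLaw_integral hZ hGZ (hf.prodMk hg)).congr
    (hZ.integral_prodMk_ae_eq hf hg)
  -- The pair is jointly Gaussian, so it suffices that all real functionals of the two components
  -- are uncorrelated. Their spectra mix ω and -ω, whence the two hypotheses on f and g.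
  refine hlaw.indepFun_of_covariance_strongDual fun L₁ L₂ => ?_
  have hcomp : ∀ {k : ℝ → ℂ} (L : StrongDual ℝ ℂ), WeightedIntegrable k →
      (L ∘ fun ω => ∫ s, (X s ω - X 0 ω) • k s) =ᵐ[P]
        fun ω => ∫ s, (X s ω - X 0 ω) • L (k s) := fun {k} L hk => by
    filter_upwards [hZ.ae_integrable hk] with ω hω
    rw [Function.comp_apply, ← L.integral_comp_comm hω]
    simp only [map_smul]
  rw [covariance_congr_ae (hcomp L₁ hf) (hcomp L₂ hg)]
  refine covariance_integral_eq_zero hX2 hXs hZ (hf.clm_comp L₁) (hg.clm_comp L₂)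
    (by rw [L₁.integral_comp_comm hf.integrable, hf0, map_zero])
    (by rw [L₂.integral_comp_comm hg.integrable, hg0, map_zero]) fun ω => ?_
  obtain ⟨a, b, hab⟩ := angularFourier_ofReal_clm_comp hf.integrable L₁
  obtain ⟨a', b', hab'⟩ := angularFourier_ofReal_clm_comp hg.integrable L₂
  rw [hab, hab', neg_neg]
  have e1 := h1 ω
  have e2 : angularFourier f ω * conj (angularFourier g ω) = 0 := by
    rcases mul_eq_zero.1 (h2 ω) with h | h <;> simp [h]
  have e3 : conj (angularFourier f (-ω)) * angularFourier g (-ω) = 0 := by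
    rcases mul_eq_zero.1 (h2 (-ω)) with h | h <;> simp [h]
  have e4 : conj (angularFourier f (-ω)) * conj (angularFourier g ω) = 0 := by
    have := h1 (-ω)
    rw [neg_neg] at this
    rw [← map_mul, this, map_zero]
  linear_combination a * a' * e1 + a * b' * e2 + b * a' * e3 + b * b' * e4

/-! ### Symmetries of the moments and the two vanishing statements. -/

lemma HasStationaryIncrements.exists_linearGrowth [IsProbabilityMeasure P] {X : ℝ → Ω → ℝ}
    (hX : Measurable (Function.uncurry X))
    (hX2 : ∀ s t : ℝ, MemLp (fun ω => X t ω - X s ω) 2 P)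
    (hXs : HasStationaryIncrements X P) :
    ∃ c : ℝ≥0, (∀ h, LinearGrowth (fun t ω => X (t + h) ω - X h ω) P c) ∧
      LinearGrowth (fun t ω => X t ω - X 0 ω) P c ∧
      LinearGrowth (fun t ω => X (-t) ω - X 0 ω) P c := by
  obtain ⟨c, hc⟩ := hXs.exists_bound hX hX2
  refine ⟨c, fun h => ?_, ?_, ?_⟩
  · exact linearGrowth_of_eLpNorm_le (measurable_increment hX (by fun_prop) measurable_const)
      fun s => by simpa using hc h (s + h)
  · exact linearGrowth_of_eLpNorm_le (measurable_increment hX measurable_id measurable_const)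
      fun s => by simpa using hc 0 s
  · exact linearGrowth_of_eLpNorm_le (measurable_increment hX (by fun_prop) measurable_const)
      fun s => by simpa using hc 0 (-s)

/-- Only increments are stationary, but the moduli ignore the random constants X(h) and X(0), so
these may be subtracted. -/
lemma modulusMoment_stationary [IsProbabilityMeasure P] {X : ℝ → Ω → ℝ} {c : ℝ≥0}
    (hXs : HasStationaryIncrements X P)
    (hsh : ∀ h, LinearGrowth (fun t ω => X (t + h) ω - X h ω) P c)
    (hZ : LinearGrowth (fun t ω => X t ω - X 0 ω) P c) {ψ : ℝ → ℂ} (hψ : IsWavelet ψ)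
    (j l : ℤ) (h p q : ℝ) :
    modulusMoment ψ X P j l (p + h) (q + h) = modulusMoment ψ X P j l p q := by
  rw [← modulusMoment_shift, ← modulusMoment_sub hψ (fun t ω => X (t + h) ω) P j l (X h),
    modulusMoment_eq_of_identDistrib (hsh h) hZ (hXs h) hψ, modulusMoment_sub hψ]

lemma modulusMoment_neg [IsProbabilityMeasure P] {X : ℝ → Ω → ℝ} {c : ℝ≥0}
    (hrev : IsTimeReversible X P)
    (hR : LinearGrowth (fun t ω => X (-t) ω - X 0 ω) P c)
    (hZ : LinearGrowth (fun t ω => X t ω - X 0 ω) P c) {ψ : ℝ → ℂ} (hψ : IsWavelet ψ)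
    (j l : ℤ) (p q : ℝ) :
    modulusMoment ψ X P j l (-p) (-q) = modulusMoment ψ X P j l p q := by
  have hid : IdentDistrib (fun ω t => X (-t) ω - X 0 ω) (fun ω t => X t ω - X 0 ω) P P := by
    have h := IdentDistrib.comp hrev
      (u := fun (x : ℝ → ℝ) (t : ℝ) => x t - x 0) (by fun_prop)
    simpa [Function.comp_def] using h
  rw [← modulusMoment_reverse hψ, ← modulusMoment_sub hψ (fun t ω => X (-t) ω) P j l (X 0),
    modulusMoment_eq_of_identDistrib hR hZ hid hψ, modulusMoment_sub hψ]

lemma im_integral_scattering_eq_zero [IsProbabilityMeasure P] {X : ℝ → Ω → ℝ} {c : ℝ≥0}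
    (hXs : HasStationaryIncrements X P) (hrev : IsTimeReversible X P)
    (hsh : ∀ h, LinearGrowth (fun t ω => X (t + h) ω - X h ω) P c)
    (hR : LinearGrowth (fun t ω => X (-t) ω - X 0 ω) P c)
    (hZ : LinearGrowth (fun t ω => X t ω - X 0 ω) P c) {ψ : ℝ → ℂ} (hψ : IsWavelet ψ)
    (j l k : ℤ) (t : ℝ) :
    (∫ ω, scatteringTransform ψ (fun u => X u ω) j k t *
        conj (scatteringTransform ψ (fun u => X u ω) l k t) ∂P).im = 0 := by
  rw [integral_scattering_mul_conj hZ hψ, ← Complex.conj_eq_iff_im]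
  have hneg := modulusMoment_neg hrev hR hZ hψ j l
  have hst := modulusMoment_stationary hXs hsh hZ hψ j l
  -- The substitution p ↦ (t, t) - p removes t; the moment absorbs the shift by stationarity and the
  -- sign by reversibility.
  have hN : ∫ p : ℝ × ℝ, (modulusMoment ψ X P j l p.1 p.2 : ℂ) *
        (dilate ψ k (t - p.1) * conj (dilate ψ k (t - p.2))) =
      ∫ p : ℝ × ℝ, (modulusMoment ψ X P j l p.1 p.2 : ℂ) *
        (dilate ψ k p.1 * conj (dilate ψ k p.2)) := by
    rw [← integral_sub_left_eq_self _ volume ((t, t) : ℝ × ℝ)]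
    refine integral_congr_ae (ae_of_all _ fun p => ?_)
    simp only [Prod.fst_sub, Prod.snd_sub, sub_sub_cancel]
    congr 2
    rw [← hneg p.1 p.2, ← hst t (-p.1) (-p.2)]
    congr 1 <;> ring
  rw [hN, ← integral_conj]
  conv_rhs => rw [← integral_neg_eq_self]
  refine integral_congr_ae ?_
  have h1 : ∀ᵐ p : ℝ × ℝ, dilate ψ k (-p.1) = conj (dilate ψ k p.1) :=
    Measure.quasiMeasurePreserving_fst.ae (hψ.ae_dilate_neg k)
  have h2 : ∀ᵐ p : ℝ × ℝ, dilate ψ k (-p.2) = conj (dilate ψ k p.2) :=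
    Measure.quasiMeasurePreserving_snd.ae (hψ.ae_dilate_neg k)
  filter_upwards [h1, h2] with p h1 h2
  simp only [Prod.fst_neg, Prod.snd_neg, h1, h2, hneg, map_mul, Complex.conj_ofReal]

lemma integral_scattering_eq_zero_of_gaussian [IsProbabilityMeasure P] {X : ℝ → Ω → ℝ} {c : ℝ≥0}
    (hX2 : ∀ s t : ℝ, MemLp (fun ω => X t ω - X s ω) 2 P)
    (hXs : HasStationaryIncrements X P) (hG : IsGaussianProcess X P)
    (hsh : ∀ h, LinearGrowth (fun t ω => X (t + h) ω - X h ω) P c)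
    (hZ : LinearGrowth (fun t ω => X t ω - X 0 ω) P c) {ψ : ℝ → ℂ} (hψ : IsWavelet ψ)
    (hψa : IsAnalyticWavelet ψ) {j l : ℤ}
    (hjl : ∀ ω : ℝ, angularFourier (dilate ψ j) ω * angularFourier (dilate ψ l) ω = 0)
    (k : ℤ) (t : ℝ) :
    ∫ ω, scatteringTransform ψ (fun u => X u ω) j k t *
        conj (scatteringTransform ψ (fun u => X u ω) l k t) ∂P = 0 := by
  have hvan : ∀ (i : ℤ) (ω : ℝ), ω ≤ 0 → angularFourier (dilate ψ i) ω = 0 := fun i ω hω => by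
    rcases hω.lt_or_eq with h | rfl
    · rw [angularFourier_dilate]
      exact hψa _ (mul_neg_of_pos_of_neg (by positivity) h)
    · have := hψ.integral_dilate i
      simpa [angularFourier] using this
  -- Here analyticity enters: spectra carried by positive frequencies do not meet after a
  -- reflection, which removes the pseudo-covariance.
  have hopp : ∀ ω : ℝ,
      angularFourier (dilate ψ j) (-ω) * angularFourier (dilate ψ l) ω = 0 := fun ω => by
    rcases le_total ω 0 with h | h
    · rw [hvan l ω h, mul_zero]
    · rw [hvan j (-ω) (by linarith), zero_mul]
  have hmodZ : ∀ (i : ℤ) (p : ℝ) (ω : Ω), waveletModulus ψ (fun u => X u ω) i p =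
      ‖∫ s, (X s ω - X 0 ω) • dilate ψ i (p - s)‖ := fun i p ω => by
    rw [waveletModulus, ← hψ.waveletTransform_sub_const _ (X 0 ω)]
    rfl
  -- Independence holds for every pair of times, not only at p = q, so the whole kernel factors.
  have hsplit : ∀ p q, modulusMoment ψ X P j l p q =
      (∫ ω, waveletModulus ψ (fun u => X u ω) j p ∂P) *
        ∫ ω, waveletModulus ψ (fun u => X u ω) l q ∂P := fun p q => by
    have hf := (hψ.weightedIntegrable_dilate j).comp_sub_left p
    have hg := (hψ.weightedIntegrable_dilate l).comp_sub_left q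
    have hind := indepFun_integral hX2 hXs hG hZ hf hg (hψ.integral_dilate_sub_left j p)
      (hψ.integral_dilate_sub_left l q)
      (fun ω => by
        rw [angularFourier_comp_sub_left, angularFourier_comp_sub_left, neg_neg, mul_mul_mul_comm,
          hopp, mul_zero])
      (fun ω => by
        rw [angularFourier_comp_sub_left, angularFourier_comp_sub_left, mul_mul_mul_comm,
          hjl, mul_zero])
    have hnorm := hind.comp (φ := fun z : ℂ => ‖z‖) (ψ := fun z : ℂ => ‖z‖) measurable_norm
      measurable_norm
    simp only [modulusMoment, hmodZ]
    exact hnorm.integral_fun_mul_eq_mul_integral (hZ.memLp_integral hf).norm.1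
      (hZ.memLp_integral hg).norm.1
  have hmean : ∀ (i : ℤ) (p : ℝ), ∫ ω, waveletModulus ψ (fun u => X u ω) i p ∂P =
      ∫ ω, waveletModulus ψ (fun u => X u ω) i 0 ∂P := fun i p => by
    have hid := identDistrib_integral (hsh p) hZ (hXs p)
      ((hψ.weightedIntegrable_dilate i).comp_sub_left 0)
    have h := (hid.comp measurable_norm).integral_eq
    simp only [hmodZ i 0]
    refine Eq.trans (integral_congr_ae (ae_of_all _ fun ω => ?_)) h
    have h1 := waveletTransform_shift ψ (fun s => X s ω) i p 0
    rw [zero_add] at h1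
    simp only [waveletModulus, Function.comp_apply]
    rw [← h1, ← hψ.waveletTransform_sub_const _ (X p ω)]
    rfl
  rw [integral_scattering_mul_conj hZ hψ]
  simp_rw [hsplit]
  simp_rw [fun p : ℝ × ℝ => hmean j p.1, fun p : ℝ × ℝ => hmean l p.2]
  rw [integral_const_mul]
  have := integral_prod_mul (μ := (volume : Measure ℝ)) (ν := (volume : Measure ℝ))
    (fun p => dilate ψ k (t - p)) (fun q => conj (dilate ψ k (t - q)))
  rw [hψ.integral_dilate_sub_left, zero_mul] at this
  rw [Measure.volume_eq_prod, this, mul_zero]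

end Scattering

theorem mainTheorem3 {Ω : Type*} [MeasurableSpace Ω] (P : Measure Ω) [IsProbabilityMeasure P]
    (ψ : ℝ → ℂ) (hψ : Scattering.IsWavelet ψ)
    (X : ℝ → Ω → ℝ) (hX : Measurable (Function.uncurry X))
    (hX2 : ∀ s t : ℝ, MemLp (fun ω => X t ω - X s ω) 2 P)
    (hXs : Scattering.HasStationaryIncrements X P) :
    Scattering.IsWellDefined ψ X P ∧
    (Scattering.IsAnalyticWavelet ψ → IsGaussianProcess X P →
      ∀ j a : ℤ,
        (∀ ω : ℝ, Scattering.angularFourier (Scattering.dilate ψ j) ω *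
          Scattering.angularFourier (Scattering.dilate ψ (j - a)) ω = 0) →
        ∀ (b : ℤ) (t : ℝ), Scattering.crossSpectrum ψ X P j a b t = 0) ∧
    (Scattering.IsTimeReversible X P →
      ∀ (j a b : ℤ) (t : ℝ), (Scattering.crossSpectrum ψ X P j a b t).im = 0) := by
  obtain ⟨c, hsh, hZ, hR⟩ := hXs.exists_linearGrowth hX hX2
  refine ⟨Scattering.isWellDefined_of_linearGrowth hZ hψ, ?_, ?_⟩
  · intro hψa hG j a hja b t
    rw [Scattering.crossSpectrum, Scattering.integral_scattering_eq_zero_of_gaussian hX2 hXs hG hsh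
      hZ hψ hψa hja, zero_div]
  · intro hrev j a b t
    rw [Scattering.crossSpectrum, Complex.div_ofReal_im,
      Scattering.im_integral_scattering_eq_zero hXs hrev hsh hR hZ hψ, zero_div]
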